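/- Draw the complete graph $K_4$ in the plane as a wheel: a hub $C$ and rim vertices $P,Q,R$ in this counterclockwise order around $C$. Let $T$ be the Y-shaped tree formed by the three spokes $CP, CQ, CR$, and let $T'$ be the dual Y-shaped tree, whose three edges start in the outer region, cross the rim edges $PQ, QR, RP$, and end in the triangles $CPQ, CQR, CRP$, respectively. For integers $p,q,r,a,b,c$ let $K\left(\begin{smallmatrix} p&q&r\\ a&b&c\end{smallmatrix}\right)$ be the unoriented link whose diagram on the sphere is obtained as follows. Along each of the six tree edges run two parallel strands, one on each side of the edge. The ends of strands of neighbouring tree edges are joined, inside the region of the plane where they lie, by arcs without crossings (three around $C$, three in the outer region, two in each of the three triangles), so that without twists one obtains the boundary curve of a neighbourhood of $T$. Finally, $|p|,|q|,|r|$ half twists (crossings) are inserted in the pairs of strands along $CP,CQ,CR$, and $|a|,|b|,|c|$ half twists in the pairs of strands along the edges of $T'$ crossing $PQ,QR,RP$. The sign of a label fixes the handedness of its half twists: if the two strands are given antiparallel directions, the crossings are positive for a positive label and negative for a negative label. Two links are regarded as equal if they are isotopic, that is, if their diagrams are related by planar isotopy and finitely many Reidemeister moves. **Theorem 4.10.**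 Suppose that $p,q,r,a,b,c$ are even integers and $p\neq a$. If $$K\left(\begin{smallmatrix} p&q&r\\ a&b&c\end{smallmatrix}\right)=K\left(\begin{smallmatrix} a&q&r\\ p&b&c\end{smallmatrix}\right),$$ then either $q=c=0$, or $q=c$ and $b=r$. -/

import Mathlib

/-!
Knots are given by diagrams on the sphere, and two diagrams present the same (unoriented) knot or
link when they are related by planar isotopy and Reidemeister moves.

A diagram is recorded as a planar diagram code.  The diagram is cut at finitely many points; each
cut point has a label.  The pieces are plain arcs and crossings.
-/

/-- A piece of a link diagram whose ends carry labels.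
* `strand a b` is an arc without crossings with ends `a` and `b`.
* `crossing a b c d` is one crossing; its four ends are `a`, `b`, `c`, `d` in counterclockwise
  order, the strand from `a` to `c` passes under the strand from `b` to `d`. -/
inductive Item (L : Type) : Type
  | strand (a b : L) : Item L
  | crossing (a b c d : L) : Item L

namespace Item

variable {L : Type}

/-- The ends of a piece, in counterclockwise order. -/
def ends : Item L → List L
  | strand a b => [a, b]
  | crossing a b c d => [a, b, c, d]

/-- Change the labels of the ends. -/
def map (f : L → L) : Item L → Item L
  | strand a b => strand (f a) (f b)
  | crossing a b c d => crossing (f a) (f b) (f c) (f d)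

end Item

/-- A diagram code: a finite list of pieces, to be glued at ends that carry the same label.
The order of the list has no meaning (see `Move.perm`). -/
abbrev DiagramCode (L : Type) : Type := List (Item L)

namespace DiagramCode

variable {L : Type}

/-- All ends of all pieces. -/
def allEnds (D : DiagramCode L) : List L := D.flatMap Item.ends

/-- Every label that occurs is carried by exactly two ends, which are glued to each other. -/
def Glued [DecidableEq L] (D : DiagramCode L) : Prop :=
  ∀ x ∈ D.allEnds, D.allEnds.count x = 2

/-- The half-edges of the 4-valent graph (with extra vertices of valence 2 at the strands) that
underlies the diagram: an index of a piece and a position among the ends of that piece. -/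
abbrev HalfEdge (D : DiagramCode L) : Type :=
  (i : Fin D.length) × Fin (D.get i).ends.length

/-- The label of a half-edge. -/
def label (D : DiagramCode L) (h : D.HalfEdge) : L := (D.get h.1).ends.get h.2

/-- The next half-edge at the same piece in counterclockwise order. -/
def ccw (D : DiagramCode L) (h : D.HalfEdge) : D.HalfEdge := ⟨h.1, finRotate _ h.2⟩

/-- Corners of the complementary regions: the half-edge `h` also stands for the corner between `h`
and the next half-edge `ccw h`.  Following the edge that starts with `ccw h` to its other half `k`,
with the region on the right, one gets to the corner between `k` and `ccw k`
of the same region. -/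
def FaceStep (D : DiagramCode L) (h k : D.HalfEdge) : Prop :=
  k ≠ D.ccw h ∧ D.label k = D.label (D.ccw h)

/-- The number of complementary regions, each connected part being put on its own sphere. -/
noncomputable def faceCount (D : DiagramCode L) : ℕ := Nat.card (Quot D.FaceStep)

/-- Two half-edges at the same piece or on the same edge. -/
def Adjacent (D : DiagramCode L) (h k : D.HalfEdge) : Prop :=
  h.1 = k.1 ∨ D.label h = D.label k

/-- The number of connected parts of the underlying graph. -/
noncomputable def partCount (D : DiagramCode L) : ℕ := Nat.card (Quot D.Adjacent)

/-- Every connected part of the diagram lies on the sphere, by Euler's formula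
`V - E + F = 2 * (number of connected parts)`. -/
def Planar [DecidableEq L] (D : DiagramCode L) : Prop :=
  D.length + D.faceCount = D.allEnds.toFinset.card + 2 * D.partCount

/-- The codes of link diagrams. -/
def IsLinkDiagram [DecidableEq L] (D : DiagramCode L) : Prop := D.Glued ∧ D.Planar

open Item in
/-- Changes of the code that do not change the diagram (`perm` to `absorb`), and
the Reidemeister moves (`r1` to `r3'`).  In every move `D` is the part of the diagram
that is left alone. -/
inductive Move [DecidableEq L] : DiagramCode L → DiagramCode L → Prop
  /-- The order of the pieces is irrelevant. -/
  | perm (D D' : DiagramCode L) (h : D.Perm D') : Move D D'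
  /-- The direction of a plain arc is irrelevant. -/
  | flip (a b : L) (D : DiagramCode L) : Move (strand a b :: D) (strand b a :: D)
  /-- The counterclockwise list of ends may start at either end of the lower strand. -/
  | rotate (a b c d : L) (D : DiagramCode L) :
      Move (crossing a b c d :: D) (crossing c d a b :: D)
  /-- A plain arc can be absorbed into what it is glued to. -/
  | absorb (a b : L) (hab : a ≠ b) (D : DiagramCode L) :
      Move (strand a b :: D) (List.map (Item.map fun x => if x = b then a else x) D)
  /-- First Reidemeister move. -/
  | r1 (a c d : L) (D : DiagramCode L) :
      Move (crossing a a c d :: D) (strand c d :: D)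
  /-- First Reidemeister move, curl of the other sign. -/
  | r1' (a b d : L) (D : DiagramCode L) :
      Move (crossing a b b d :: D) (strand a d :: D)
  /-- Second Reidemeister move: on the left hand side the arc from `x₁` to `y₁` passes under the
  arc from `x₂` to `y₂` twice, and the two crossings span a bigon with edges `u₁`, `u₂`. -/
  | r2 (x₁ x₂ y₁ y₂ u₁ u₂ : L) (D : DiagramCode L) :
      Move (crossing x₁ x₂ u₂ u₁ :: crossing u₂ y₂ y₁ u₁ :: D)
        (strand x₁ y₁ :: strand x₂ y₂ :: D)
  /-- Third Reidemeister move: the arc from `x₁` to `y₃` is below the arc from `x₂` to `y₂`, which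
  is below the arc from `x₃` to `y₁`.  The triangle has edges `u₁`, `u₂`, `v`, resp.
  `s₂`, `s₃`, `t`. -/
  | r3 (x₁ x₂ x₃ y₁ y₂ y₃ u₁ u₂ v s₂ s₃ t : L) (D : DiagramCode L) :
      Move (crossing x₁ x₂ u₂ u₁ :: crossing u₂ x₃ y₃ v :: crossing u₁ v y₂ y₁ :: D)
        (crossing x₂ x₃ s₃ s₂ :: crossing x₁ s₂ t y₁ :: crossing t s₃ y₃ y₂ :: D)
  /-- Third Reidemeister move, with all crossings changed. -/
  | r3' (x₁ x₂ x₃ y₁ y₂ y₃ u₁ u₂ v s₂ s₃ t : L) (D : DiagramCode L) :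
      Move (crossing x₂ u₂ u₁ x₁ :: crossing x₃ y₃ v u₂ :: crossing v y₂ y₁ u₁ :: D)
        (crossing x₃ s₃ s₂ x₂ :: crossing s₂ t y₁ x₁ :: crossing s₃ y₃ y₂ t :: D)

/-- A single move between two link diagrams.  (Since the code on both sides has to be a link
diagram, the labels of inner edges are new, and a second Reidemeister move can only
create crossings between arcs that can be brought next to each other.) -/
def Step [DecidableEq L] (D D' : DiagramCode L) : Prop :=
  D.IsLinkDiagram ∧ D'.IsLinkDiagram ∧ Move D D'

/-- The diagrams present the same unoriented knot or link: they are related by finitely many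
moves, in both directions.  (To be used with an infinite set of labels.) -/
def SameKnot [DecidableEq L] (D D' : DiagramCode L) : Prop := Relation.EqvGen Step D D'

end DiagramCode

/-!
The diagram of girth 3.  Draw the complete graph with 4 vertices in the plane: a hub `C` and three
rim vertices `P`, `Q`, `R`, counterclockwise around `C`.  The Y-shaped tree `T` consists of the
spokes `p = CP`, `q = CQ`, `r = CR`.  The rim edges are `PQ`, `QR`, `RP`, and the Y-shaped tree `T'`
consists of the three edges `a`, `b`, `c` of the dual graph that cross these; they join the outer
region to the triangles `CPQ`, `CQR`, `CRP`.  Spokes are directed from `C` outwards and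
`a`, `b`, `c` from the outer region inwards.  Along each of the six edges there are two parallel
strands, on the left and on the right of the edge, twisted as often as the label of the edge says.
-/

/-- The edges of the two Y-shaped trees. -/
inductive TreeEdge : Type
  | p | q | r | a | b | c
  deriving DecidableEq

/-- A cut point: on the left or on the right of the edge, after `level` half twists. -/
structure CutPoint : Type where
  edge : TreeEdge
  left : Bool
  level : ℕ
  deriving DecidableEq

namespace Girth3

/-- The cut point on the left of `e`, after `j` half twists. -/
def lt (e : TreeEdge) (j : ℕ) : CutPoint := ⟨e, true, j⟩

/-- The cut point on the right of `e`, after `j` half twists. -/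
def rt (e : TreeEdge) (j : ℕ) : CutPoint := ⟨e, false, j⟩

/-- A row of `|n|` half twists along the edge `e`.  The sign of `n` says which strand
is on top: for antiparallel strands the crossings are positive if `n > 0` and negative
if `n < 0`. -/
def twist (e : TreeEdge) (n : ℤ) : DiagramCode CutPoint :=
  (List.range n.natAbs).map fun j =>
    if 0 < n then Item.crossing (lt e j) (rt e j) (rt e (j + 1)) (lt e (j + 1))
    else Item.crossing (rt e j) (rt e (j + 1)) (lt e (j + 1)) (lt e j)

open Item TreeEdge in
/-- The diagram with rows of `p, q, r` half twists on the edges of `T` and `a, b, c` half twists on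
the edges of `T'`. -/
def K (np nq nr na nb nc : ℤ) : DiagramCode CutPoint :=
  twist p np ++ twist q nq ++ twist r nr ++ twist a na ++ twist b nb ++ twist c nc ++
  [ -- around the hub `C`
    strand (lt p 0) (rt q 0), strand (lt q 0) (rt r 0), strand (lt r 0) (rt p 0),
    -- around the outer region
    strand (lt a 0) (rt c 0), strand (lt b 0) (rt a 0), strand (lt c 0) (rt b 0),
    -- in the triangle `CPQ`
    strand (lt p np.natAbs) (lt a na.natAbs), strand (rt q nq.natAbs) (rt a na.natAbs),
    -- in the triangle `CQR`
    strand (lt q nq.natAbs) (lt b nb.natAbs), strand (rt r nr.natAbs) (rt b nb.natAbs),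
    -- in the triangle `CRP`
    strand (lt r nr.natAbs) (lt c nc.natAbs), strand (rt p np.natAbs) (rt c nc.natAbs) ]

end Girth3

/-! The proof compares Alexander polynomials, read off from numbers of quandle colourings so that
invariance can be checked move by move. For a unit `t` of a commutative ring, a colouring is
constant along an overstrand, and a strand of colour x passing under colour y acquires the colour y
+ t^{±1}(x - y), the exponent being given by the direction of the overstrand. Every move matches
orientations on its two sides with equally many colourings. As links are unoriented here, the
invariant is the set of these numbers over all orientations (`SameKnot.colorCounts_eq`).

For even labels the diagram has exactly two orientations, one the reverse of the other
(`isOrientation_K_iff`), and the strands of every row are antiparallel. A full twist keeps the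
difference of the two colours and shifts both by a multiple of it. Hence a colouring amounts to one
free colour and two differences subject to a 2 × 2 linear system (`card_arcRelations`). Its
coefficients are integers once σ = 2 - t - t⁻¹ is one, and they are the same for both orientations.
The determinant has the form 1 - σA + σ²B (`det_systemMatrix`); this is the Alexander polynomial,
normalised to be 1 at t = 1.

To recover the determinant from finite counts, work over (ℤ/m)[t]/(t² - (2 - σ)t + 1), where m is a
nonzero multiple of it. There are then m² det² colourings (`colorCounts_K`), and the sign is fixed
by det ≡ 1 mod σ for σ ≥ 3 (`det_systemMatrix_eq_of_sameKnot`). The values at σ = 3 and σ = 4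
determine A and B. In terms of the halved labels, exchanging p and a changes A by (p - a)(c - q),
and, once q = c, changes B by (p - a)q²(b - r). -/

/-! Orientations of diagram codes and their colourings by Alexander quandles. -/

namespace Item

variable {L : Type}

/-- The bit at an end of a piece is `true` if the strand enters the piece there.  Every strand of a
directed piece enters at one end and leaves at the other. -/
def Directed : Item (L × Bool) → Prop
  | strand a b => b.2 = !a.2
  | crossing a b c d => c.2 = !a.2 ∧ d.2 = !b.2

/-- The multiplier of the Alexander quandle at a crossing whose overstrand has direction `b`. -/
def weight {R : Type*} [CommRing R] (t : Rˣ) (b : Bool) : R := if b then ↑t⁻¹ else ↑t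

/-- The condition on the colours of the ends of a directed piece. -/
def Colored {R : Type*} [CommRing R] (t : Rˣ) (f : L → R) : Item (L × Bool) → Prop
  | strand a b => f a.1 = f b.1
  | crossing a b c d =>
      f b.1 = f d.1 ∧ f c.1 = f b.1 + weight t b.2 * (f a.1 - f b.1)

/-- Forget the directions. -/
def forget : Item (L × Bool) → Item L
  | strand a b => strand a.1 b.1
  | crossing a b c d => crossing a.1 b.1 c.1 d.1

/-- `i` is the piece `d` with a direction. -/
def Lifts (i : Item (L × Bool)) (d : Item L) : Prop := i.forget = d ∧ i.Directed

/-- Reversing the overstrand inverts the multiplier. This inverse is what undoes an underpass in the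
second Reidemeister move and in reading a crossing backwards. -/
theorem weight_mul_weight_not {R : Type*} [CommRing R] (t : Rˣ) (b : Bool) :
    weight t b * weight t (!b) = 1 := by
  cases b <;> simp [weight]

theorem Colored.congr {R : Type*} [CommRing R] {t : Rˣ} {f g : L → R} {i : Item (L × Bool)}
    (hi : i.Colored t f) (hfg : ∀ x ∈ i.ends, f x.1 = g x.1) : i.Colored t g := by
  cases i <;> simp only [Colored, ends, List.mem_cons, List.not_mem_nil, or_false, forall_eq_or_imp,
    forall_eq] at hi hfg ⊢
  · rw [← hfg.1, ← hfg.2, hi]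
  · rw [← hfg.1, ← hfg.2.1, ← hfg.2.2.1, ← hfg.2.2.2]
    exact hi

theorem lifts_strand {i : Item (L × Bool)} {a b : L} :
    i.Lifts (strand a b) ↔ ∃ j, i = strand (a, j) (b, !j) := by
  constructor
  · rintro ⟨h, h'⟩
    rcases i with ⟨⟨a', j⟩, ⟨b', k⟩⟩ | _ <;> simp only [forget, strand.injEq, reduceCtorEq] at h
    obtain ⟨rfl, rfl⟩ := h
    obtain rfl : k = !j := h'
    exact ⟨j, rfl⟩
  · rintro ⟨j, rfl⟩
    simp [Lifts, forget, Directed]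

theorem lifts_crossing {i : Item (L × Bool)} {a b c d : L} :
    i.Lifts (crossing a b c d) ↔ ∃ j k, i = crossing (a, j) (b, k) (c, !j) (d, !k) := by
  constructor
  · rintro ⟨h, h'⟩
    rcases i with _ | ⟨⟨a', j⟩, ⟨b', k⟩, ⟨c', j'⟩, ⟨d', k'⟩⟩ <;>
      simp only [forget, crossing.injEq, reduceCtorEq] at h
    obtain ⟨rfl, rfl, rfl, rfl⟩ := h
    obtain ⟨rfl, rfl⟩ : j' = (!j) ∧ k' = !k := h'
    exact ⟨j, k, rfl⟩
  · rintro ⟨j, k, rfl⟩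
    simp [Lifts, forget, Directed]

theorem ends_map (g : L → L) (i : Item L) : (i.map g).ends = i.ends.map g := by
  cases i <;> rfl

theorem ends_forget (i : Item (L × Bool)) : i.forget.ends = i.ends.map Prod.fst := by
  cases i <;> rfl

end Item

/-! ### Counting colourings, and comparing counts across a local change -/

namespace DiagramCode

open Item

variable {L : Type} {R : Type*} [CommRing R]

/-- `E` is the diagram code `D` with an orientation. -/
def IsOrientation (E : DiagramCode (L × Bool)) (D : DiagramCode L) : Prop :=
  List.Forall₂ Lifts E D ∧ E.allEnds.Nodup

/-- The colourings of the labels of an oriented diagram code. -/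
def colorings (t : Rˣ) (E : DiagramCode (L × Bool)) : Set (L → R) :=
  {f | (∀ i ∈ E, i.Colored t f) ∧ ∀ x, (∀ e ∈ E.allEnds, e.1 ≠ x) → f x = 0}

/-- The numbers of colourings for all orientations of a diagram code. -/
def colorCounts (t : Rˣ) (D : DiagramCode L) : Set ℕ :=
  {n | ∃ E : DiagramCode (L × Bool), E.IsOrientation D ∧ Nat.card (colorings t E) = n}

@[simp] theorem allEnds_nil : allEnds ([] : DiagramCode L) = [] := rfl

@[simp] theorem allEnds_strand_cons (a b : L) (D : DiagramCode L) :
    allEnds (strand a b :: D) = a :: b :: D.allEnds := rfl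

@[simp] theorem allEnds_crossing_cons (a b c d : L) (D : DiagramCode L) :
    allEnds (crossing a b c d :: D) = a :: b :: c :: d :: D.allEnds := rfl

@[simp] theorem allEnds_append (D D' : DiagramCode L) :
    allEnds (D ++ D') = D.allEnds ++ D'.allEnds := by simp [allEnds]

theorem allEnds_map (g : L → L) (D : DiagramCode L) :
    allEnds (D.map (Item.map g)) = D.allEnds.map g := by
  simp [allEnds, List.map_flatMap, List.flatMap_map, ends_map]

theorem allEnds_lift {E : DiagramCode (L × Bool)} {D : DiagramCode L}
    (h : List.Forall₂ Lifts E D) : E.allEnds.map Prod.fst = D.allEnds := by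
  induction h with
  | nil => rfl
  | cons h _ ih =>
    obtain ⟨rfl, -⟩ := h
    simp only [allEnds, List.flatMap_cons, List.map_append, ends_forget] at ih ⊢
    rw [ih]

theorem mem_allEnds_of_mem {E : DiagramCode L} {i : Item L} (hi : i ∈ E) {x : L}
    (hx : x ∈ i.ends) : x ∈ E.allEnds := List.mem_flatMap.2 ⟨i, hi, hx⟩

theorem colorings_congr (t : Rˣ) {E E' : DiagramCode (L × Bool)}
    (h : ∀ f : L → R, (∀ i ∈ E, i.Colored t f) ↔ ∀ i ∈ E', i.Colored t f)
    (h' : ∀ e, e ∈ E.allEnds ↔ e ∈ E'.allEnds) : colorings t E = colorings t E' := by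
  ext f
  simp [colorings, h, h']

/-- Restriction to the labels outside `I` is injective on both sets of colourings, and the two
images agree. -/
theorem card_colorings_eq (t : Rˣ) {E E' : DiagramCode (L × Bool)} (I : Set L)
    (h : ∀ f ∈ colorings t E, ∃ f' ∈ colorings t E', ∀ x ∉ I, f' x = f x)
    (h' : ∀ f ∈ colorings t E', ∃ f' ∈ colorings t E, ∀ x ∉ I, f' x = f x)
    (u : ∀ f ∈ colorings t E, ∀ g ∈ colorings t E, (∀ x ∉ I, f x = g x) → f = g)
    (u' : ∀ f ∈ colorings t E', ∀ g ∈ colorings t E', (∀ x ∉ I, f x = g x) → f = g) :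
    Nat.card (colorings t E) = Nat.card (colorings t E') := by
  choose! φ hφ hφ' using h
  refine Nat.card_congr (Equiv.ofBijective (fun f => ⟨φ f, hφ _ f.2⟩) ⟨?_, ?_⟩)
  · rintro ⟨f, hf⟩ ⟨g, hg⟩ hfg
    simp only [Subtype.mk.injEq] at hfg ⊢
    exact u f hf g hg fun x hx => by rw [← hφ' f hf x hx, ← hφ' g hg x hx, hfg]
  · rintro ⟨f, hf⟩
    obtain ⟨g, hg, hgf⟩ := h' f hf
    exact ⟨⟨g, hg⟩, Subtype.ext (u' _ (hφ g hg) _ hf fun x hx => by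
      rw [hφ' g hg x hx, hgf x hx])⟩

theorem exists_coloring_of_local (t : Rˣ) {A A' F : DiagramCode (L × Bool)} (I : Set L)
    (hF : ∀ e ∈ F.allEnds, e.1 ∉ I)
    (hA : ∀ e ∈ A.allEnds, e.1 ∈ I ∨ ∃ e' ∈ A'.allEnds, e'.1 = e.1)
    (ext : ∀ f : L → R, (∀ i ∈ A, i.Colored t f) →
      ∃ f' : L → R, (∀ i ∈ A', i.Colored t f') ∧ ∀ x ∉ I, f' x = f x)
    (f : L → R) (hf : f ∈ colorings t (A ++ F)) :
    ∃ f' ∈ colorings t (A' ++ F), ∀ x ∉ I, f' x = f x := by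
  classical
  obtain ⟨f', h1, h2⟩ := ext f fun i hi => hf.1 i (by simp [hi])
  -- Labels that do not occur must have colour 0, so the extension is cut off outside the new code.
  refine ⟨fun x => if ∃ e ∈ (A' ++ F).allEnds, e.1 = x then f' x else 0, ⟨?_, ?_⟩, ?_⟩
  · intro i hi
    have hc : i.Colored t f' := by
      rcases List.mem_append.1 hi with h | h
      · exact h1 i h
      · exact (hf.1 i (by simp [h])).congr fun x hx =>
          (h2 _ (hF _ (mem_allEnds_of_mem h hx))).symm
    exact hc.congr fun x hx => (if_pos ⟨x, mem_allEnds_of_mem hi hx, rfl⟩).symm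
  · intro x hx
    exact if_neg (by rintro ⟨e, he, rfl⟩; exact hx e he rfl)
  · intro x hx
    dsimp only
    split_ifs with hx'
    · exact h2 x hx
    · refine (hf.2 x ?_).symm
      rintro e he rfl
      simp only [allEnds_append, List.mem_append] at he hx'
      rcases he with he | he
      · obtain h | ⟨e', h, h''⟩ := hA e he
        · exact hx h
        · exact hx' ⟨e', Or.inl h, h''⟩
      · exact hx' ⟨e, Or.inr he, rfl⟩

theorem coloring_ext_of_local (t : Rˣ) {A F : DiagramCode (L × Bool)} (I : Set L)
    (uniq : ∀ f g : L → R, (∀ i ∈ A, i.Colored t f) → (∀ i ∈ A, i.Colored t g) →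
      (∀ x ∉ I, f x = g x) → ∀ e ∈ A.allEnds, f e.1 = g e.1)
    (f : L → R) (hf : f ∈ colorings t (A ++ F)) (g : L → R) (hg : g ∈ colorings t (A ++ F))
    (hF : ∀ e ∈ F.allEnds, e.1 ∉ I)
    (hfg : ∀ x ∉ I, f x = g x) : f = g := by
  ext x
  by_cases hx : ∃ e ∈ (A ++ F).allEnds, e.1 = x
  · obtain ⟨e, he, rfl⟩ := hx
    rw [allEnds_append, List.mem_append] at he
    rcases he with he | he
    · exact uniq f g (fun i hi => hf.1 i (by simp [hi])) (fun i hi => hg.1 i (by simp [hi]))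
        hfg e he
    · exact hfg _ (hF e he)
  · have hx' : ∀ e ∈ (A ++ F).allEnds, e.1 ≠ x := by rintro e he rfl; exact hx ⟨e, he, rfl⟩
    rw [hf.2 x hx', hg.2 x hx']

/-- A local change of an oriented diagram code, from `A` to `A'`, does not change the number of
colourings if in `A` and `A'` the colours of the inner labels `I` are determined by the other ones,
and if the conditions on the other ones are the same. -/
theorem card_colorings_local (t : Rˣ) {A A' F : DiagramCode (L × Bool)} (I : Set L)
    (hF : ∀ e ∈ F.allEnds, e.1 ∉ I)
    (hA : ∀ e ∈ A.allEnds, e.1 ∈ I ∨ ∃ e' ∈ A'.allEnds, e'.1 = e.1)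
    (hA' : ∀ e ∈ A'.allEnds, e.1 ∈ I ∨ ∃ e' ∈ A.allEnds, e'.1 = e.1)
    (ext : ∀ f : L → R, (∀ i ∈ A, i.Colored t f) →
      ∃ f' : L → R, (∀ i ∈ A', i.Colored t f') ∧ ∀ x ∉ I, f' x = f x)
    (ext' : ∀ f : L → R, (∀ i ∈ A', i.Colored t f) →
      ∃ f' : L → R, (∀ i ∈ A, i.Colored t f') ∧ ∀ x ∉ I, f' x = f x)
    (uniq : ∀ f g : L → R, (∀ i ∈ A, i.Colored t f) → (∀ i ∈ A, i.Colored t g) →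
      (∀ x ∉ I, f x = g x) → ∀ e ∈ A.allEnds, f e.1 = g e.1)
    (uniq' : ∀ f g : L → R, (∀ i ∈ A', i.Colored t f) → (∀ i ∈ A', i.Colored t g) →
      (∀ x ∉ I, f x = g x) → ∀ e ∈ A'.allEnds, f e.1 = g e.1) :
    Nat.card (colorings t (A ++ F)) = Nat.card (colorings t (A' ++ F)) :=
  card_colorings_eq t I (exists_coloring_of_local t I hF hA ext)
    (exists_coloring_of_local t I hF hA' ext')
    (fun f hf g hg => coloring_ext_of_local t I uniq f hf g hg hF)
    (fun f hf g hg => coloring_ext_of_local t I uniq' f hf g hg hF)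

theorem colorCounts_eq (t : Rˣ) {D D' : DiagramCode L}
    (h : ∀ E : DiagramCode (L × Bool), E.IsOrientation D →
      ∃ E' : DiagramCode (L × Bool), E'.IsOrientation D' ∧
        Nat.card (colorings t E) = Nat.card (colorings t E'))
    (h' : ∀ E' : DiagramCode (L × Bool), E'.IsOrientation D' →
      ∃ E : DiagramCode (L × Bool), E.IsOrientation D ∧
        Nat.card (colorings t E) = Nat.card (colorings t E')) :
    colorCounts t D = colorCounts t D' := by
  ext n
  constructor
  · rintro ⟨E, hE, rfl⟩
    obtain ⟨E', hE', he⟩ := h E hE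
    exact ⟨E', hE', he.symm⟩
  · rintro ⟨E, hE, rfl⟩
    obtain ⟨E', hE', he⟩ := h' E hE
    exact ⟨E', hE', he⟩

theorem isOrientation_strand_cons {E : DiagramCode (L × Bool)} {a b : L} {D : DiagramCode L} :
    E.IsOrientation (strand a b :: D) ↔ ∃ j F, E = strand (a, j) (b, !j) :: F ∧
      List.Forall₂ Lifts F D ∧ E.allEnds.Nodup := by
  simp only [IsOrientation, List.forall₂_cons_right_iff, lifts_strand]
  grind

theorem isOrientation_crossing_cons {E : DiagramCode (L × Bool)} {a b c d : L}
    {D : DiagramCode L} :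
    E.IsOrientation (crossing a b c d :: D) ↔
      ∃ j k F, E = crossing (a, j) (b, k) (c, !j) (d, !k) :: F ∧
        List.Forall₂ Lifts F D ∧ E.allEnds.Nodup := by
  simp only [IsOrientation, List.forall₂_cons_right_iff, lifts_crossing]
  grind

end DiagramCode

/-! ### Invariance under relabelling of pieces and the first two Reidemeister moves -/

namespace DiagramCode

open Item

variable {L : Type} {R : Type*} [CommRing R]

theorem colorCounts_perm (t : Rˣ) {D D' : DiagramCode L} (h : D.Perm D') :
    colorCounts t D = colorCounts t D' := by
  have key : ∀ {D D' : DiagramCode L}, D.Perm D' → ∀ E : DiagramCode (L × Bool),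
      E.IsOrientation D → ∃ E' : DiagramCode (L × Bool), E'.IsOrientation D' ∧
        Nat.card (colorings t E) = Nat.card (colorings t E') := by
    rintro D D' h E ⟨hE, hn⟩
    -- Lifting piece by piece commutes with permuting, so the orientation can be permuted along with
    -- the code.
    have : Relation.Comp (List.Forall₂ Lifts) List.Perm E D' := ⟨D, hE, h⟩
    rw [List.forall₂_comp_perm_eq_perm_comp_forall₂] at this
    obtain ⟨E', hp, hE'⟩ := this
    have hends : (allEnds E).Perm (allEnds E') := hp.flatMap_right _
    exact ⟨E', ⟨hE', hends.nodup_iff.1 hn⟩, by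
      rw [colorings_congr t (fun f => by simp [hp.mem_iff]) fun e => hends.mem_iff]⟩
  refine colorCounts_eq t (key h) fun E hE => ?_
  obtain ⟨E', h1, h2⟩ := key h.symm E hE
  exact ⟨E', h1, h2.symm⟩

theorem colorCounts_flip (t : Rˣ) (a b : L) (D : DiagramCode L) :
    colorCounts t (strand a b :: D) = colorCounts t (strand b a :: D) := by
  have key : ∀ a b : L, ∀ E : DiagramCode (L × Bool),
      E.IsOrientation (strand a b :: D) → ∃ E' : DiagramCode (L × Bool),
        E'.IsOrientation (strand b a :: D) ∧
        Nat.card (colorings t E) = Nat.card (colorings t E') := by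
    intro a b E hE
    obtain ⟨j, F, rfl, hF, hn⟩ := isOrientation_strand_cons.1 hE
    refine ⟨strand (b, !j) (a, j) :: F, isOrientation_strand_cons.2 ⟨!j, F, by simp, hF, ?_⟩, ?_⟩
    · simp only [allEnds_strand_cons] at hn ⊢
      exact (List.Perm.swap _ _ _).nodup_iff.1 hn
    · rw [colorings_congr t (fun f => ?_) fun e => ?_]
      · simp [Colored, eq_comm]
      · simp only [allEnds_strand_cons, List.mem_cons]
        tauto
  refine colorCounts_eq t (key a b) fun E hE => ?_
  obtain ⟨E', h1, h2⟩ := key b a E hE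
  exact ⟨E', h1, h2.symm⟩

theorem colorCounts_rotate (t : Rˣ) (a b c d : L) (D : DiagramCode L) :
    colorCounts t (crossing a b c d :: D) = colorCounts t (crossing c d a b :: D) := by
  have key : ∀ a b c d : L, ∀ E : DiagramCode (L × Bool),
      E.IsOrientation (crossing a b c d :: D) → ∃ E' : DiagramCode (L × Bool),
        E'.IsOrientation (crossing c d a b :: D) ∧
        Nat.card (colorings t E) = Nat.card (colorings t E') := by
    intro a b c d E hE
    obtain ⟨j, k, F, rfl, hF, hn⟩ := isOrientation_crossing_cons.1 hE
    refine ⟨crossing (c, !j) (d, !k) (a, j) (b, k) :: F,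
      isOrientation_crossing_cons.2 ⟨!j, !k, F, by simp, hF, ?_⟩, ?_⟩
    · simp only [allEnds_crossing_cons, List.nodup_cons, List.mem_cons, not_or] at hn ⊢
      grind
    · have hk := weight_mul_weight_not t k
      rw [colorings_congr t (fun f => ?_) fun e => ?_]
      · simp only [List.forall_mem_cons, Colored]
        refine and_congr_left fun _ => ⟨?_, ?_⟩ <;> rintro ⟨h1, h2⟩ <;> refine ⟨h1.symm, ?_⟩
        · linear_combination h1 - weight t (!k) * h2 - (f a - f b) * hk - weight t (!k) * h1
        · linear_combination h1 - weight t k * h2 - (f c - f d) * hk - weight t k * h1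
      · simp only [allEnds_crossing_cons, List.mem_cons]
        tauto
  refine colorCounts_eq t (key a b c d) fun E hE => ?_
  obtain ⟨E', h1, h2⟩ := key c d a b E hE
  exact ⟨E', h1, h2.symm⟩

/-- In an orientation all pairs of label and bit are distinct, so of two ends glued together one
enters its piece and the other leaves. This is how directions propagate across a gluing. -/
theorem eq_not_of_nodup {l : List (L × Bool)} (h : l.Nodup) {x : L} {b b' : Bool} (m n : ℕ)
    (hmn : m ≠ n) (hm : l[m]? = some (x, b)) (hn : l[n]? = some (x, b')) : b' = !b := by
  by_contra hb
  obtain rfl : b' = b := by simpa using hb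
  obtain ⟨hm', hm⟩ := List.getElem?_eq_some_iff.1 hm
  obtain ⟨hn', hn⟩ := List.getElem?_eq_some_iff.1 hn
  exact hmn ((h.getElem_inj_iff).1 (hm.trans hn.symm))

theorem nodup_cons_cons_not {l : List (L × Bool)} {x : L} {b : Bool} :
    ((x, b) :: (x, !b) :: l).Nodup ↔ (∀ e ∈ l, e.1 ≠ x) ∧ l.Nodup := by
  simp only [List.nodup_cons, List.mem_cons, not_or]
  constructor
  · rintro ⟨⟨-, h1⟩, h2, h3⟩
    refine ⟨?_, h3⟩
    rintro ⟨y, c⟩ he rfl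
    rcases Bool.eq_or_eq_not c b with rfl | rfl
    · exact h1 he
    · exact h2 he
  · rintro ⟨h1, h2⟩
    exact ⟨⟨by simp, fun h => h1 _ h rfl⟩, fun h => h1 _ h rfl, h2⟩

section Reidemeister

variable [DecidableEq L]

/-- Idempotence of the quandle: in the curl a strand passes under its own colour, which leaves the
colour unchanged. -/
theorem card_colorings_r1 (t : Rˣ) {a c d : L} {j l : Bool} {F : DiagramCode (L × Bool)}
    (hc : c ≠ a) (hd : d ≠ a) (hF : ∀ e ∈ F.allEnds, e.1 ≠ a) :
    Nat.card (colorings t (crossing (a, j) (a, l) (c, !j) (d, !l) :: F)) =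
      Nat.card (colorings t (strand (c, !j) (d, !l) :: F)) := by
  refine card_colorings_local t (A := [crossing (a, j) (a, l) (c, !j) (d, !l)])
    (A' := [strand (c, !j) (d, !l)]) (F := F) {a} hF ?_ ?_ ?_ ?_ ?_ ?_
  · simp
  · simp
  · intro f hf
    simp only [List.forall_mem_singleton, Colored] at hf ⊢
    exact ⟨f, by linear_combination hf.1 + hf.2, fun _ _ => rfl⟩
  · intro f hf
    simp only [List.forall_mem_singleton, Colored] at hf ⊢
    refine ⟨Function.update f a (f c), ?_, fun x hx => Function.update_of_ne hx _ _⟩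
    simp [hc, hd, hf]
  · intro f g hf hg hfg
    simp only [List.forall_mem_singleton, Colored] at hf hg
    have hd' := hfg d hd
    simp [hf.1, hg.1, hfg c hc, hd']
  · intro f g hf hg hfg
    simp [hfg c hc, hfg d hd]

theorem colorCounts_r1 (t : Rˣ) (a c d : L) (D : DiagramCode L)
    (h : Glued (crossing a a c d :: D)) :
    colorCounts t (crossing a a c d :: D) = colorCounts t (strand c d :: D) := by
  have hcount := h a (by simp)
  simp only [allEnds_crossing_cons, List.count_cons_self] at hcount
  have hcount : ∀ x ∈ c :: d :: D.allEnds, x ≠ a := by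
    rintro x hx rfl
    have := List.count_pos_iff.2 hx
    omega
  simp only [List.forall_mem_cons] at hcount
  obtain ⟨hc, hd, hD⟩ := hcount
  have hF : ∀ F : DiagramCode (L × Bool), List.Forall₂ Lifts F D → ∀ e ∈ F.allEnds, e.1 ≠ a :=
    fun F hF e he =>
    hD _ (allEnds_lift hF ▸ List.mem_map_of_mem he)
  refine colorCounts_eq t (fun E hE => ?_) fun E hE => ?_
  · obtain ⟨j, l, F, rfl, hF', hn⟩ := isOrientation_crossing_cons.1 hE
    obtain rfl : l = !j := eq_not_of_nodup hn 0 1 (by simp) rfl rfl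
    exact ⟨_, isOrientation_strand_cons.2 ⟨_, F, rfl, hF', (nodup_cons_cons_not.1 hn).2⟩,
      card_colorings_r1 t hc hd (hF F hF')⟩
  · obtain ⟨k, F, rfl, hF', hn⟩ := isOrientation_strand_cons.1 hE
    refine ⟨_, isOrientation_crossing_cons.2 ⟨!k, !!k, F, rfl, hF', ?_⟩, ?_⟩
    · refine nodup_cons_cons_not.2 ⟨?_, by rw [Bool.not_not]; exact hn⟩
      exact List.forall_mem_cons.2 ⟨hc, List.forall_mem_cons.2 ⟨hd, hF F hF'⟩⟩
    · rw [card_colorings_r1 t hc hd (hF F hF'), Bool.not_not]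

/-- Here the looped end is the outgoing understrand, so the equality of colours follows only after
cancelling the invertible multiplier. -/
theorem card_colorings_r1' (t : Rˣ) {a b d : L} {j l : Bool} {F : DiagramCode (L × Bool)}
    (ha : a ≠ b) (hd : d ≠ b) (hF : ∀ e ∈ F.allEnds, e.1 ≠ b) :
    Nat.card (colorings t (crossing (a, j) (b, l) (b, !j) (d, !l) :: F)) =
      Nat.card (colorings t (strand (a, j) (d, !l) :: F)) := by
  have hl := weight_mul_weight_not t l
  have hcancel : ∀ f : L → R, f b = f b + weight t l * (f a - f b) → f a = f b := fun f hf => by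
    linear_combination -weight t (!l) * hf - (f a - f b) * hl
  refine card_colorings_local t (A := [crossing (a, j) (b, l) (b, !j) (d, !l)])
    (A' := [strand (a, j) (d, !l)]) (F := F) {b} hF ?_ ?_ ?_ ?_ ?_ ?_
  · simp
  · simp
  · intro f hf
    simp only [List.forall_mem_singleton, Colored] at hf ⊢
    exact ⟨f, by rw [hcancel f hf.2, hf.1], fun _ _ => rfl⟩
  · intro f hf
    simp only [List.forall_mem_singleton, Colored] at hf ⊢
    refine ⟨Function.update f b (f a), ?_, fun x hx => Function.update_of_ne hx _ _⟩
    simp [ha, hd, hf]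
  · intro f g hf hg hfg
    simp only [List.forall_mem_singleton, Colored] at hf hg
    have hd' := hfg d hd
    simp [hf.1, hg.1, hfg a ha, hd']
  · intro f g hf hg hfg
    simp [hfg a ha, hfg d hd]

theorem colorCounts_r1' (t : Rˣ) (a b d : L) (D : DiagramCode L)
    (h : Glued (crossing a b b d :: D)) :
    colorCounts t (crossing a b b d :: D) = colorCounts t (strand a d :: D) := by
  have hcount := h b (by simp)
  simp only [allEnds_crossing_cons, List.count_cons, BEq.rfl, if_true] at hcount
  have hcount : ∀ x ∈ a :: d :: D.allEnds, x ≠ b := by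
    rintro x hx rfl
    have := List.count_pos_iff.2 hx
    simp only [List.count_cons] at this
    omega
  simp only [List.forall_mem_cons] at hcount
  obtain ⟨ha, hd, hD⟩ := hcount
  have hF : ∀ F : DiagramCode (L × Bool), List.Forall₂ Lifts F D → ∀ e ∈ F.allEnds, e.1 ≠ b :=
    fun F hF e he =>
    hD _ (allEnds_lift hF ▸ List.mem_map_of_mem he)
  refine colorCounts_eq t (fun E hE => ?_) fun E hE => ?_
  · obtain ⟨j, l, F, rfl, hF', hn⟩ := isOrientation_crossing_cons.1 hE
    obtain rfl : l = j := by simpa using (eq_not_of_nodup hn 1 2 (by simp) rfl rfl).symm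
    refine ⟨_, isOrientation_strand_cons.2 ⟨l, F, rfl, hF', ?_⟩,
      card_colorings_r1' t ha hd (hF F hF')⟩
    exact (nodup_cons_cons_not.1
      ((List.perm_append_comm (l₁ := [_]) (l₂ := [_, _]).append_right _).nodup_iff.1 hn)).2
  · obtain ⟨k, F, rfl, hF', hn⟩ := isOrientation_strand_cons.1 hE
    refine ⟨_, isOrientation_crossing_cons.2 ⟨k, k, F, rfl, hF', ?_⟩,
      card_colorings_r1' t ha hd (hF F hF')⟩
    refine (List.perm_append_comm (l₁ := [_]) (l₂ := [_, _]).append_right _).nodup_iff.2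
      (nodup_cons_cons_not.2 ⟨?_, hn⟩)
    exact List.forall_mem_cons.2 ⟨ha, List.forall_mem_cons.2 ⟨hd, hF F hF'⟩⟩

/-- A label has exactly two ends, so once both are displayed it cannot occur elsewhere; this makes
inner labels of a move new. -/
theorem Glued.ne_of_perm {D : DiagramCode L} (h : D.Glued) {x : L} {l : List L}
    (hl : D.allEnds.Perm (x :: x :: l)) : ∀ y ∈ l, y ≠ x := by
  rintro y hy rfl
  have h2 := h y (hl.mem_iff.2 (by simp))
  rw [hl.count_eq, List.count_cons_self, List.count_cons_self] at h2
  have := List.count_pos_iff.2 hy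
  omega

/-- The lower arc meets the same overstrand twice with opposite bits, so the second multiplier
inverts the first and the arc leaves with its original colour. -/
theorem card_colorings_r2 (t : Rˣ) {x₁ x₂ y₁ y₂ u₁ u₂ : L} {j k : Bool}
    {F : DiagramCode (L × Bool)} (hu : u₁ ≠ u₂)
    (h₁ : ∀ y ∈ [x₁, x₂, y₁, y₂], y ≠ u₁) (h₂ : ∀ y ∈ [x₁, x₂, y₁, y₂], y ≠ u₂)
    (hF : ∀ e ∈ F.allEnds, e.1 ≠ u₁ ∧ e.1 ≠ u₂) :
    Nat.card (colorings t (crossing (x₁, j) (x₂, k) (u₂, !j) (u₁, !k) ::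
      crossing (u₂, j) (y₂, !k) (y₁, !j) (u₁, k) :: F)) =
      Nat.card (colorings t (strand (x₁, j) (y₁, !j) :: strand (x₂, k) (y₂, !k) :: F)) := by
  have hk := weight_mul_weight_not t k
  simp only [List.forall_mem_cons] at h₁ h₂
  refine card_colorings_local t (A := [crossing (x₁, j) (x₂, k) (u₂, !j) (u₁, !k),
    crossing (u₂, j) (y₂, !k) (y₁, !j) (u₁, k)])
    (A' := [strand (x₁, j) (y₁, !j), strand (x₂, k) (y₂, !k)]) (F := F) {u₁, u₂}
      ?_ ?_ ?_ ?_ ?_ ?_ ?_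
  · simpa using hF
  · simp
  · simp
  · intro f hf
    simp only [List.forall_mem_cons, Colored] at hf ⊢
    obtain ⟨⟨e1, e2⟩, ⟨e3, e4⟩, -⟩ := hf
    refine ⟨f, ⟨?_, ?_, by simp⟩, fun _ _ => rfl⟩
    · rw [e4, e2, e3, e1]
      linear_combination -(f x₁ - f u₁) * hk
    · rw [e1, e3]
  · intro f hf
    simp only [List.forall_mem_cons, Colored] at hf ⊢
    obtain ⟨e1, e2, -⟩ := hf
    refine ⟨Function.update (Function.update f u₁ (f x₂)) u₂ (f x₂ + weight t k * (f x₁ - f x₂)),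
      ?_, fun x hx => ?_⟩
    · simp only [Function.update_self, Function.update_of_ne hu, Function.update_of_ne h₁.1,
        Function.update_of_ne h₂.1, Function.update_of_ne h₁.2.1, Function.update_of_ne h₂.2.1,
        Function.update_of_ne h₁.2.2.1, Function.update_of_ne h₂.2.2.1,
        Function.update_of_ne h₁.2.2.2.1, Function.update_of_ne h₂.2.2.2.1]
      refine ⟨⟨trivial, trivial⟩, ⟨e2.symm, ?_⟩, by simp⟩
      rw [← e2, ← e1]
      linear_combination -(f x₁ - f x₂) * hk
    · simp only [Set.mem_insert_iff, Set.mem_singleton_iff, not_or] at hx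
      rw [Function.update_of_ne hx.2, Function.update_of_ne hx.1]
  · intro f g hf hg hfg
    simp only [List.forall_mem_cons, Colored] at hf hg
    have a1 := hfg x₁ (by simp [h₁, h₂])
    have a2 := hfg x₂ (by simp [h₁, h₂])
    have a3 := hfg y₁ (by simp [h₁, h₂])
    have a4 := hfg y₂ (by simp [h₁, h₂])
    have a5 : f u₁ = g u₁ := by rw [← hf.1.1, ← hg.1.1, a2]
    have a6 : f u₂ = g u₂ := by rw [hf.1.2, hg.1.2, a1, a2]
    simp [a1, a2, a3, a4, a5, a6]
  · intro f g hf hg hfg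
    have a1 := hfg x₁ (by simp [h₁, h₂])
    have a2 := hfg x₂ (by simp [h₁, h₂])
    have a3 := hfg y₁ (by simp [h₁, h₂])
    have a4 := hfg y₂ (by simp [h₁, h₂])
    simp [a1, a2, a3, a4]

theorem colorCounts_r2 (t : Rˣ) (x₁ x₂ y₁ y₂ u₁ u₂ : L) (D : DiagramCode L)
    (h : Glued (crossing x₁ x₂ u₂ u₁ :: crossing u₂ y₂ y₁ u₁ :: D)) :
    colorCounts t (crossing x₁ x₂ u₂ u₁ :: crossing u₂ y₂ y₁ u₁ :: D) =
      colorCounts t (strand x₁ y₁ :: strand x₂ y₂ :: D) := by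
  have g₁ := h.ne_of_perm (x := u₁) (l := u₂ :: u₂ :: x₁ :: x₂ :: y₁ :: y₂ :: D.allEnds) (by
    rw [List.perm_iff_count]; intro a; simp only [allEnds_crossing_cons, List.count_cons]; ring)
  have g₂ := h.ne_of_perm (x := u₂) (l := u₁ :: u₁ :: x₁ :: x₂ :: y₁ :: y₂ :: D.allEnds) (by
    rw [List.perm_iff_count]; intro a; simp only [allEnds_crossing_cons, List.count_cons]; ring)
  have hu : u₁ ≠ u₂ := g₂ u₁ (by simp)
  have h₁ : ∀ y ∈ [x₁, x₂, y₁, y₂], y ≠ u₁ := fun y hy => g₁ y (by simp at hy ⊢; tauto)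
  have h₂ : ∀ y ∈ [x₁, x₂, y₁, y₂], y ≠ u₂ := fun y hy => g₂ y (by simp at hy ⊢; tauto)
  have hF : ∀ F : DiagramCode (L × Bool), List.Forall₂ Lifts F D →
    ∀ e ∈ F.allEnds, e.1 ≠ u₁ ∧ e.1 ≠ u₂ := by
    intro F hF e he
    have : e.1 ∈ D.allEnds := allEnds_lift hF ▸ List.mem_map_of_mem he
    exact ⟨g₁ _ (by simp [this]), g₂ _ (by simp [this])⟩
  have hp : ∀ j k F, (allEnds (crossing (x₁, j) (x₂, k) (u₂, !j) (u₁, !k) ::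
      crossing (u₂, j) (y₂, !k) (y₁, !j) (u₁, k) :: F)).Perm
      ((u₁, k) :: (u₁, !k) :: (u₂, j) :: (u₂, !j) ::
        (x₁, j) :: (y₁, !j) :: (x₂, k) :: (y₂, !k) :: allEnds F) := by
    intro j k F
    rw [List.perm_iff_count]; intro a; simp only [allEnds_crossing_cons, List.count_cons]; ring
  refine colorCounts_eq t (fun E hE => ?_) fun E hE => ?_
  · obtain ⟨j, k, F, rfl, hF', hn⟩ := isOrientation_crossing_cons.1 hE
    simp only [List.forall₂_cons_right_iff, lifts_crossing] at hF'
    obtain ⟨_, F, ⟨j', k', rfl⟩, hF', rfl⟩ := hF'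
    -- Positions 2 and 4 in the list of ends are those of `u₂`; 3 and 7 are those of `u₁`.
    obtain rfl : j' = j := by simpa using eq_not_of_nodup hn 2 4 (by simp) rfl rfl
    obtain rfl : k' = !k := by
      rw [← Bool.not_inj_iff]
      exact eq_not_of_nodup hn 3 7 (by simp) rfl rfl
    refine ⟨_, isOrientation_strand_cons.2 ⟨j', _, rfl, .cons (lifts_strand.2 ⟨k, rfl⟩)
      hF', ?_⟩, ?_⟩
    · exact (nodup_cons_cons_not.1 (nodup_cons_cons_not.1
        ((hp j' k F).nodup_iff.1 (by simpa using hn))).2).2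
    · rw [Bool.not_not, card_colorings_r2 t hu h₁ h₂ (hF F hF')]
  · obtain ⟨j, F, rfl, hF', hn⟩ := isOrientation_strand_cons.1 hE
    simp only [List.forall₂_cons_right_iff, lifts_strand] at hF'
    obtain ⟨_, F, ⟨k, rfl⟩, hF', rfl⟩ := hF'
    refine ⟨crossing (x₁, j) (x₂, k) (u₂, !j) (u₁, !k) ::
      crossing (u₂, j) (y₂, !k) (y₁, !j) (u₁, k) :: F, isOrientation_crossing_cons.2 ⟨j, k, _, rfl,
        .cons (lifts_crossing.2 ⟨j, !k, by simp⟩) hF', ?_⟩, ?_⟩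
    · refine (hp j k F).nodup_iff.2
        (nodup_cons_cons_not.2 ⟨?_, nodup_cons_cons_not.2 ⟨?_, by simpa using hn⟩⟩)
      · simp only [List.forall_mem_cons] at h₁ ⊢
        exact ⟨hu.symm, hu.symm, h₁.1, h₁.2.2.1, h₁.2.1, h₁.2.2.2.1, fun e he => (hF F hF' e he).1⟩
      · simp only [List.forall_mem_cons] at h₂ ⊢
        exact ⟨h₂.1, h₂.2.2.1, h₂.2.1, h₂.2.2.2.1, fun e he => (hF F hF' e he).2⟩
    · rw [card_colorings_r2 t hu h₁ h₂ (hF F hF')]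

end Reidemeister

end DiagramCode

/-! ### Colourings of the two sides of the third Reidemeister move -/

namespace DiagramCode

open Item

variable {L : Type} {R : Type*} [CommRing R]

/-- In the part `A` of an oriented diagram code, with outer labels `O` and inner labels `I`, the
colours of the inner labels are determined by the outer ones, which are subject to `P`. -/
structure IsTangle (t : Rˣ) (A : DiagramCode (L × Bool)) (O I : List L) (P : (L → R) → Prop) :
    Prop where
  mem_or_mem : ∀ e ∈ A.allEnds, e.1 ∈ O ∨ e.1 ∈ I
  exists_mem : ∀ x ∈ O, ∃ e ∈ A.allEnds, e.1 = x
  sound : ∀ f : L → R, (∀ i ∈ A, i.Colored t f) → P f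
  complete : ∀ f : L → R, P f → ∃ f' : L → R, (∀ i ∈ A, i.Colored t f') ∧ ∀ x ∉ I, f' x = f x
  unique : ∀ f g : L → R, (∀ i ∈ A, i.Colored t f) → (∀ i ∈ A, i.Colored t g) →
      (∀ x ∈ O, f x = g x) → ∀ x ∈ I, f x = g x

theorem IsTangle.card_colorings_eq {t : Rˣ} {A A' F : DiagramCode (L × Bool)} {O I I' : List L}
    {P : (L → R) → Prop} (hA : IsTangle t A O I P) (hA' : IsTangle t A' O I' P)
    (hO : ∀ x ∈ O, x ∉ I ∧ x ∉ I') (hF : ∀ e ∈ F.allEnds, e.1 ∉ I ∧ e.1 ∉ I') :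
    Nat.card (colorings t (A ++ F)) = Nat.card (colorings t (A' ++ F)) := by
  have hu : ∀ {B : DiagramCode (L × Bool)} {J : List L}, IsTangle t B O J P → ∀ f g : L → R,
      (∀ i ∈ B, i.Colored t f) → (∀ i ∈ B, i.Colored t g) →
      (∀ x ∉ {x | x ∈ I ∨ x ∈ I'}, f x = g x) → ∀ e ∈ B.allEnds, f e.1 = g e.1 := by
    intro B J hB f g hf hg hfg e he
    have h : ∀ x ∈ O, f x = g x := fun x hx => hfg x (not_or.2 (hO x hx))
    rcases hB.mem_or_mem e he with h1 | h1
    · exact h _ h1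
    · exact hB.unique f g hf hg h _ h1
  refine card_colorings_local t {x | x ∈ I ∨ x ∈ I'} (fun e he => not_or.2 (hF e he)) ?_ ?_ ?_ ?_
    (hu hA) (hu hA')
  · intro e he
    exact (hA.mem_or_mem e he).symm.imp Or.inl (hA'.exists_mem _)
  · intro e he
    exact (hA'.mem_or_mem e he).symm.imp Or.inr (hA.exists_mem _)
  · intro f hf
    obtain ⟨f', h1, h2⟩ := hA'.complete f (hA.sound f hf)
    exact ⟨f', h1, fun x hx => h2 x (not_or.1 hx).2⟩
  · intro f hf
    obtain ⟨f', h1, h2⟩ := hA.complete f (hA'.sound f hf)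
    exact ⟨f', h1, fun x hx => h2 x (not_or.1 hx).1⟩

variable [DecidableEq L]

/-- The six outer colours are related by carrying colours along the strands from `x₁`, `x₂`, `x₃`.
The other side of the move yields the same relations, by self-distributivity of the quandle
operation. -/
theorem isTangle_r3_left (t : Rˣ) {x₁ x₂ x₃ y₁ y₂ y₃ u₁ u₂ v : L} (i j k : Bool)
    (h12 : u₁ ≠ u₂) (h1v : u₁ ≠ v) (h2v : u₂ ≠ v)
    (h : ∀ x ∈ [x₁, x₂, x₃, y₁, y₂, y₃], x ∉ [u₁, u₂, v]) :
    IsTangle t [crossing (x₁, i) (x₂, j) (u₂, !i) (u₁, !j),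
      crossing (u₂, i) (x₃, k) (y₃, !i) (v, !k), crossing (u₁, j) (v, k) (y₂, !j) (y₁, !k)]
      [x₁, x₂, x₃, y₁, y₂, y₃] [u₁, u₂, v] fun f => f y₁ = f x₃ ∧
        f y₂ = f x₃ + weight t k * (f x₂ - f x₃) ∧
        f y₃ = f x₃ + weight t k * (f x₂ + weight t j * (f x₁ - f x₂) - f x₃) where
  mem_or_mem := by simp
  exists_mem := by simp
  sound f hf := by
    simp only [List.forall_mem_cons, Colored] at hf
    obtain ⟨⟨e1, e2⟩, ⟨e3, e4⟩, ⟨e5, e6⟩, -⟩ := hf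
    rw [e4, e6, ← e5, ← e3, e2, ← e1]
    exact ⟨rfl, rfl, rfl⟩
  complete f hf := by
    simp only [List.forall_mem_cons] at h
    simp only [List.mem_cons, List.not_mem_nil, or_false, not_or] at h
    refine ⟨Function.update (Function.update (Function.update f u₁ (f x₂)) u₂
      (f x₂ + weight t j * (f x₁ - f x₂))) v (f x₃), ?_, ?_⟩
    · simp only [List.forall_mem_cons, Colored, Function.update_apply, h, h12, h12.symm, h1v,
        h1v.symm, h2v, h2v.symm, if_true, if_false, hf]
      simp
    · intro x hx
      simp only [List.mem_cons, List.not_mem_nil, or_false, not_or] at hx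
      simp only [Function.update_apply, hx, if_false]
  unique f g hf hg hfg := by
    simp only [List.forall_mem_cons, Colored] at hf hg hfg ⊢
    obtain ⟨⟨e1, e2⟩, ⟨e3, e4⟩, ⟨e5, e6⟩, -⟩ := hf
    obtain ⟨⟨e1', e2'⟩, ⟨e3', e4'⟩, ⟨e5', e6'⟩, -⟩ := hg
    refine ⟨?_, ?_, ?_, by simp⟩
    · rw [← e1, ← e1', hfg.2.1]
    · rw [e2, e2', hfg.1, hfg.2.1]
    · rw [← e3, ← e3', hfg.2.2.1]

theorem isTangle_r3_right (t : Rˣ) {x₁ x₂ x₃ y₁ y₂ y₃ s₂ s₃ w : L} (i j k : Bool)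
    (h12 : s₂ ≠ s₃) (h1v : s₂ ≠ w) (h2v : s₃ ≠ w)
    (h : ∀ x ∈ [x₁, x₂, x₃, y₁, y₂, y₃], x ∉ [s₂, s₃, w]) :
    IsTangle t [crossing (x₂, j) (x₃, k) (s₃, !j) (s₂, !k),
      crossing (x₁, i) (s₂, k) (w, !i) (y₁, !k), crossing (w, i) (s₃, j) (y₃, !i) (y₂, !j)]
      [x₁, x₂, x₃, y₁, y₂, y₃] [s₂, s₃, w] fun f => f y₁ = f x₃ ∧
        f y₂ = f x₃ + weight t k * (f x₂ - f x₃) ∧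
        f y₃ = f x₃ + weight t k * (f x₂ + weight t j * (f x₁ - f x₂) - f x₃) where
  mem_or_mem := by simp
  exists_mem := by simp
  sound f hf := by
    simp only [List.forall_mem_cons, Colored] at hf
    obtain ⟨⟨e1, e2⟩, ⟨e3, e4⟩, ⟨e5, e6⟩, -⟩ := hf
    refine ⟨by rw [← e3, ← e1], by rw [← e5, e2], ?_⟩
    rw [e6, e4, e2, ← e1]
    ring
  complete f hf := by
    simp only [List.forall_mem_cons] at h
    simp only [List.mem_cons, List.not_mem_nil, or_false, not_or] at h
    refine ⟨Function.update (Function.update (Function.update f s₂ (f x₃)) s₃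
      (f x₃ + weight t k * (f x₂ - f x₃))) w (f x₃ + weight t k * (f x₁ - f x₃)), ?_, ?_⟩
    · simp only [List.forall_mem_cons, Colored, Function.update_apply, h, h12, h12.symm, h1v,
        h1v.symm, h2v, h2v.symm, if_true, if_false, hf]
      simp
      ring
    · intro x hx
      simp only [List.mem_cons, List.not_mem_nil, or_false, not_or] at hx
      simp only [Function.update_apply, hx, if_false]
  unique f g hf hg hfg := by
    simp only [List.forall_mem_cons, Colored] at hf hg hfg ⊢
    obtain ⟨⟨e1, e2⟩, ⟨e3, e4⟩, ⟨e5, e6⟩, -⟩ := hf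
    obtain ⟨⟨e1', e2'⟩, ⟨e3', e4'⟩, ⟨e5', e6'⟩, -⟩ := hg
    refine ⟨?_, ?_, ?_, by simp⟩
    · rw [← e1, ← e1', hfg.2.2.1]
    · rw [e2, e2', hfg.2.1, hfg.2.2.1]
    · rw [e4, e4', ← e1, ← e1', hfg.1, hfg.2.2.1]

/-- With all crossings changed the strand from `x₁` to `y₃` lies on top. The middle strand has bit
`j` at `x₂`, but where it passes over, the end listed second carries `!j`, hence the multiplier
`weight t (!j)`. -/
theorem isTangle_r3'_left (t : Rˣ) {x₁ x₂ x₃ y₁ y₂ y₃ u₁ u₂ v : L} (i j k : Bool)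
    (h12 : u₁ ≠ u₂) (h1v : u₁ ≠ v) (h2v : u₂ ≠ v)
    (h : ∀ x ∈ [x₁, x₂, x₃, y₁, y₂, y₃], x ∉ [u₁, u₂, v]) :
    IsTangle t [crossing (x₂, j) (u₂, i) (u₁, !j) (x₁, !i),
      crossing (x₃, k) (y₃, i) (v, !k) (u₂, !i), crossing (v, k) (y₂, !j) (y₁, !k) (u₁, j)]
      [x₁, x₂, x₃, y₁, y₂, y₃] [u₁, u₂, v] fun f => f y₃ = f x₁ ∧
        f y₂ = f x₁ + weight t i * (f x₂ - f x₁) ∧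
        f y₁ = f x₁ + weight t i * (f x₂ + weight t (!j) * (f x₃ - f x₂) - f x₁) where
  mem_or_mem := by simp
  exists_mem := by simp
  sound f hf := by
    simp only [List.forall_mem_cons, Colored] at hf
    obtain ⟨⟨e1, e2⟩, ⟨e3, e4⟩, ⟨e5, e6⟩, -⟩ := hf
    refine ⟨by rw [e3, e1], by rw [e5, e2, e1], ?_⟩
    rw [e6, e4, e5, e2, e3, e1]
    ring
  complete f hf := by
    simp only [List.forall_mem_cons] at h
    simp only [List.mem_cons, List.not_mem_nil, or_false, not_or] at h
    refine ⟨Function.update (Function.update (Function.update f u₂ (f x₁)) u₁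
      (f x₁ + weight t i * (f x₂ - f x₁))) v (f x₁ + weight t i * (f x₃ - f x₁)), ?_, ?_⟩
    · simp only [List.forall_mem_cons, Colored, Function.update_apply, h, h12, h12.symm, h1v,
        h1v.symm, h2v, h2v.symm, if_true, if_false, hf]
      simp
      ring
    · intro x hx
      simp only [List.mem_cons, List.not_mem_nil, or_false, not_or] at hx
      simp only [Function.update_apply, hx, if_false]
  unique f g hf hg hfg := by
    simp only [List.forall_mem_cons, Colored] at hf hg hfg ⊢
    obtain ⟨⟨e1, e2⟩, ⟨e3, e4⟩, ⟨e5, e6⟩, -⟩ := hf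
    obtain ⟨⟨e1', e2'⟩, ⟨e3', e4'⟩, ⟨e5', e6'⟩, -⟩ := hg
    refine ⟨?_, ?_, ?_, by simp⟩
    · rw [← e5, ← e5', hfg.2.2.2.2.1]
    · rw [e1, e1', hfg.1]
    · rw [e4, e4', hfg.2.2.1, hfg.2.2.2.2.2.1]

theorem isTangle_r3'_right (t : Rˣ) {x₁ x₂ x₃ y₁ y₂ y₃ s₂ s₃ w : L} (i j k : Bool)
    (h12 : s₂ ≠ s₃) (h1v : s₂ ≠ w) (h2v : s₃ ≠ w)
    (h : ∀ x ∈ [x₁, x₂, x₃, y₁, y₂, y₃], x ∉ [s₂, s₃, w]) :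
    IsTangle t [crossing (x₃, k) (s₃, !j) (s₂, !k) (x₂, j),
      crossing (s₂, k) (w, i) (y₁, !k) (x₁, !i), crossing (s₃, j) (y₃, i) (y₂, !j) (w, !i)]
      [x₁, x₂, x₃, y₁, y₂, y₃] [s₂, s₃, w] fun f => f y₃ = f x₁ ∧
        f y₂ = f x₁ + weight t i * (f x₂ - f x₁) ∧
        f y₁ = f x₁ + weight t i * (f x₂ + weight t (!j) * (f x₃ - f x₂) - f x₁) where
  mem_or_mem := by simp
  exists_mem := by simp
  sound f hf := by
    simp only [List.forall_mem_cons, Colored] at hf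
    obtain ⟨⟨e1, e2⟩, ⟨e3, e4⟩, ⟨e5, e6⟩, -⟩ := hf
    rw [e6, e4, e2, e5, e3, e1]
    exact ⟨rfl, rfl, rfl⟩
  complete f hf := by
    simp only [List.forall_mem_cons] at h
    simp only [List.mem_cons, List.not_mem_nil, or_false, not_or] at h
    refine ⟨Function.update (Function.update (Function.update f s₃ (f x₂)) s₂
      (f x₂ + weight t (!j) * (f x₃ - f x₂))) w (f x₁), ?_, ?_⟩
    · simp only [List.forall_mem_cons, Colored, Function.update_apply, h, h12, h12.symm, h1v,
        h1v.symm, h2v, h2v.symm, if_true, if_false, hf]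
      simp
    · intro x hx
      simp only [List.mem_cons, List.not_mem_nil, or_false, not_or] at hx
      simp only [Function.update_apply, hx, if_false]
  unique f g hf hg hfg := by
    simp only [List.forall_mem_cons, Colored] at hf hg hfg ⊢
    obtain ⟨⟨e1, e2⟩, ⟨e3, e4⟩, ⟨e5, e6⟩, -⟩ := hf
    obtain ⟨⟨e1', e2'⟩, ⟨e3', e4'⟩, ⟨e5', e6'⟩, -⟩ := hg
    refine ⟨?_, ?_, ?_, by simp⟩
    · rw [e2, e2', e1, e1', hfg.2.1, hfg.2.2.1]
    · rw [e1, e1', hfg.2.1]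
    · rw [e3, e3', hfg.1]

end DiagramCode

/-! ### Invariance under the third Reidemeister move and absorption; the link invariant -/

namespace DiagramCode

open Item

variable {L : Type} {R : Type*} [CommRing R]

theorem nodup_of_perm {l l₁ l₂ : List (L × Bool)} {x y z : L} {i j k : Bool}
    (hp : l.Perm ((x, i) :: (x, !i) :: (y, j) :: (y, !j) :: (z, k) :: (z, !k) :: (l₁ ++ l₂)))
    (h : x ≠ y ∧ x ≠ z ∧ y ≠ z) (h₁ : ∀ a ∈ l₁.map Prod.fst, a ∉ [x, y, z])
      (h₂ : ∀ e ∈ l₂, e.1 ∉ [x, y, z])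
    (hl : (l₁ ++ l₂).Nodup) : l.Nodup := by
  have h' : ∀ e ∈ l₁ ++ l₂, e.1 ∉ [x, y, z] := by
    intro e he
    rcases List.mem_append.1 he with he | he
    · exact h₁ _ (List.mem_map_of_mem he)
    · exact h₂ e he
  simp only [List.mem_cons, List.not_mem_nil, or_false, not_or] at h'
  refine hp.nodup_iff.2 (nodup_cons_cons_not.2 ⟨?_, nodup_cons_cons_not.2
    ⟨?_, nodup_cons_cons_not.2 ⟨?_, hl⟩⟩⟩)
  · simp only [List.forall_mem_cons]
    exact ⟨h.1.symm, h.1.symm, h.2.1.symm, h.2.1.symm, fun e he => (h' e he).1⟩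
  · simp only [List.forall_mem_cons]
    exact ⟨h.2.2.symm, h.2.2.symm, fun e he => (h' e he).2.1⟩
  · exact fun e he => (h' e he).2.2

theorem nodup_of_nodup_of_perm {l l₁ : List (L × Bool)} {x y z : L} {i j k : Bool}
    (hp : l.Perm ((x, i) :: (x, !i) :: (y, j) :: (y, !j) :: (z, k) :: (z, !k) :: l₁))
    (hl : l.Nodup) : l₁.Nodup :=
  (nodup_cons_cons_not.1 (nodup_cons_cons_not.1 (nodup_cons_cons_not.1 (hp.nodup_iff.1 hl)).2).2).2

theorem isOrientation_three {c₁ c₂ c₃ : Item (L × Bool)} {d₁ d₂ d₃ : Item L}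
    {F : DiagramCode (L × Bool)} {D : DiagramCode L} (h₁ : c₁.Lifts d₁) (h₂ : c₂.Lifts d₂)
    (h₃ : c₃.Lifts d₃) (hF : List.Forall₂ Lifts F D) (hn : (allEnds (c₁ :: c₂ :: c₃ :: F)).Nodup) :
    IsOrientation (c₁ :: c₂ :: c₃ :: F) (d₁ :: d₂ :: d₃ :: D) :=
  ⟨.cons h₁ (.cons h₂ (.cons h₃ hF)), hn⟩

variable [DecidableEq L]

/-- Three inner labels of a code, each of which occurs twice in the first part of the code. -/
theorem Glued.inner_of_perm {D D₀ : DiagramCode L} (h : D.Glued) {O : List L} {x y z : L}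
    (hp : D.allEnds.Perm (x :: x :: y :: y :: z :: z :: (O ++ D₀.allEnds))) :
    (x ≠ y ∧ x ≠ z ∧ y ≠ z) ∧ (∀ a ∈ O, a ∉ [x, y, z]) ∧
      ∀ F : DiagramCode (L × Bool), List.Forall₂ Lifts F D₀ →
        ∀ e ∈ F.allEnds, e.1 ∉ [x, y, z] := by
  have hx := h.ne_of_perm hp
  have hy := h.ne_of_perm (x := y) (l := x :: x :: z :: z :: (O ++ D₀.allEnds)) (hp.trans (by
    rw [List.perm_iff_count]; intro a; simp only [List.count_cons]; ring))
  have hz := h.ne_of_perm (x := z) (l := x :: x :: y :: y :: (O ++ D₀.allEnds)) (hp.trans (by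
    rw [List.perm_iff_count]; intro a; simp only [List.count_cons]; ring))
  have key : ∀ a ∈ O ++ D₀.allEnds, a ∉ [x, y, z] := by
    intro a ha
    simp only [List.mem_cons, List.not_mem_nil, or_false, not_or]
    exact ⟨hx a (by simp only [List.mem_cons]; tauto), hy a (by simp only [List.mem_cons]; tauto),
      hz a (by simp only [List.mem_cons]; tauto)⟩
  refine ⟨⟨hy x (by simp), hz x (by simp), hz y (by simp)⟩,
    fun a ha => key a (List.mem_append_left _ ha), fun F hF e he =>
      key _ (List.mem_append_right _ ?_)⟩
  exact allEnds_lift hF ▸ List.mem_map_of_mem he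

theorem colorCounts_r3 (t : Rˣ) (x₁ x₂ x₃ y₁ y₂ y₃ u₁ u₂ v s₂ s₃ w : L) (D : DiagramCode L)
    (h : Glued (crossing x₁ x₂ u₂ u₁ :: crossing u₂ x₃ y₃ v :: crossing u₁ v y₂ y₁ :: D))
    (h' : Glued (crossing x₂ x₃ s₃ s₂ :: crossing x₁ s₂ w y₁ :: crossing w s₃ y₃ y₂ :: D)) :
    colorCounts t (crossing x₁ x₂ u₂ u₁ :: crossing u₂ x₃ y₃ v :: crossing u₁ v y₂ y₁ :: D) =
      colorCounts t (crossing x₂ x₃ s₃ s₂ :: crossing x₁ s₂ w y₁ :: crossing w s₃ y₃ y₂ :: D) := by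
  obtain ⟨hu, hO, hF⟩ := h.inner_of_perm (x := u₁) (y := u₂) (z := v) (D₀ := D)
    (O := [x₁, x₂, x₃, y₁, y₂, y₃]) (by
      rw [List.perm_iff_count]; intro a
      simp only [allEnds_crossing_cons, List.count_cons, List.cons_append, List.nil_append]; ring)
  obtain ⟨hs, hO', hF'⟩ := h'.inner_of_perm (x := s₂) (y := s₃) (z := w) (D₀ := D)
    (O := [x₁, x₂, x₃, y₁, y₂, y₃]) (by
      rw [List.perm_iff_count]; intro a
      simp only [allEnds_crossing_cons, List.count_cons, List.cons_append, List.nil_append]; ring)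
  have hp : ∀ i j k F, (allEnds (crossing (x₁, i) (x₂, j) (u₂, !i) (u₁, !j) ::
      crossing (u₂, i) (x₃, k) (y₃, !i) (v, !k) :: crossing (u₁, j) (v, k) (y₂, !j) (y₁, !k) ::
      F)).Perm ((u₁, j) :: (u₁, !j) :: (u₂, i) :: (u₂, !i) :: (v, k) :: (v, !k) ::
        ([(x₁, i), (x₂, j), (x₃, k), (y₁, !k), (y₂, !j), (y₃, !i)] ++ allEnds F)) := by
    intro i j k F
    rw [List.perm_iff_count]; intro a
    simp only [allEnds_crossing_cons, List.count_cons, List.cons_append, List.nil_append]; ring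
  have hp' : ∀ i j k F, (allEnds (crossing (x₂, j) (x₃, k) (s₃, !j) (s₂, !k) ::
      crossing (x₁, i) (s₂, k) (w, !i) (y₁, !k) :: crossing (w, i) (s₃, j) (y₃, !i) (y₂, !j) ::
      F)).Perm ((s₂, k) :: (s₂, !k) :: (s₃, j) :: (s₃, !j) :: (w, i) :: (w, !i) ::
        ([(x₁, i), (x₂, j), (x₃, k), (y₁, !k), (y₂, !j), (y₃, !i)] ++ allEnds F)) := by
    intro i j k F
    rw [List.perm_iff_count]; intro a
    simp only [allEnds_crossing_cons, List.count_cons, List.cons_append, List.nil_append]; ring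
  have hc : ∀ i j k F, List.Forall₂ Lifts F D → _ := fun i j k F hFD =>
    (isTangle_r3_left t i j k hu.1 hu.2.1 hu.2.2 hO).card_colorings_eq
      (isTangle_r3_right t i j k hs.1 hs.2.1 hs.2.2 hO') (F := F)
      (fun x hx => ⟨hO x hx, hO' x hx⟩) (fun e he => ⟨hF F hFD e he, hF' F hFD e he⟩)
  refine colorCounts_eq t (fun E hE => ?_) fun E hE => ?_
  · obtain ⟨i, j, F, rfl, hE, hn⟩ := isOrientation_crossing_cons.1 hE
    simp only [List.forall₂_cons_right_iff, lifts_crossing] at hE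
    obtain ⟨_, _, ⟨i', k, rfl⟩, ⟨_, F, ⟨j', k', rfl⟩, hFD, rfl⟩, rfl⟩ := hE
    obtain rfl : i' = i := by simpa using eq_not_of_nodup hn 2 4 (by simp) rfl rfl
    obtain rfl : j' = j := by simpa using eq_not_of_nodup hn 3 8 (by simp) rfl rfl
    obtain rfl : k' = k := by simpa using eq_not_of_nodup hn 7 9 (by simp) rfl rfl
    refine ⟨_, isOrientation_three (lifts_crossing.2 ⟨j', k', rfl⟩) (lifts_crossing.2 ⟨i', k', rfl⟩)
      (lifts_crossing.2 ⟨i', j', rfl⟩) hFD ?_, hc i' j' k' F hFD⟩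
    refine nodup_of_perm (hp' _ _ _ _) hs hO' (hF' F hFD) (nodup_of_nodup_of_perm (hp _ _ _ _) hn)
  · obtain ⟨j, k, F, rfl, hE, hn⟩ := isOrientation_crossing_cons.1 hE
    simp only [List.forall₂_cons_right_iff, lifts_crossing] at hE
    obtain ⟨_, _, ⟨i, k', rfl⟩, ⟨_, F, ⟨i', j', rfl⟩, hFD, rfl⟩, rfl⟩ := hE
    obtain rfl : j' = j := by simpa using eq_not_of_nodup hn 2 9 (by simp) rfl rfl
    obtain rfl : k' = k := by simpa using eq_not_of_nodup hn 3 5 (by simp) rfl rfl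
    obtain rfl : i' = i := by simpa using eq_not_of_nodup hn 6 8 (by simp) rfl rfl
    refine ⟨_, isOrientation_three (lifts_crossing.2 ⟨i', j', rfl⟩) (lifts_crossing.2 ⟨i', k', rfl⟩)
      (lifts_crossing.2 ⟨j', k', rfl⟩) hFD ?_, hc i' j' k' F hFD⟩
    refine nodup_of_perm (hp _ _ _ _) hu hO (hF F hFD) (nodup_of_nodup_of_perm (hp' _ _ _ _) hn)

theorem colorCounts_r3' (t : Rˣ) (x₁ x₂ x₃ y₁ y₂ y₃ u₁ u₂ v s₂ s₃ w : L) (D : DiagramCode L)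
    (h : Glued (crossing x₂ u₂ u₁ x₁ :: crossing x₃ y₃ v u₂ :: crossing v y₂ y₁ u₁ :: D))
    (h' : Glued (crossing x₃ s₃ s₂ x₂ :: crossing s₂ w y₁ x₁ :: crossing s₃ y₃ y₂ w :: D)) :
    colorCounts t (crossing x₂ u₂ u₁ x₁ :: crossing x₃ y₃ v u₂ :: crossing v y₂ y₁ u₁ :: D) =
      colorCounts t (crossing x₃ s₃ s₂ x₂ :: crossing s₂ w y₁ x₁ :: crossing s₃ y₃ y₂ w :: D) := by
  obtain ⟨hu, hO, hF⟩ := h.inner_of_perm (x := u₁) (y := u₂) (z := v) (D₀ := D)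
    (O := [x₁, x₂, x₃, y₁, y₂, y₃]) (by
      rw [List.perm_iff_count]; intro a
      simp only [allEnds_crossing_cons, List.count_cons, List.cons_append, List.nil_append]; ring)
  obtain ⟨hs, hO', hF'⟩ := h'.inner_of_perm (x := s₂) (y := s₃) (z := w) (D₀ := D)
    (O := [x₁, x₂, x₃, y₁, y₂, y₃]) (by
      rw [List.perm_iff_count]; intro a
      simp only [allEnds_crossing_cons, List.count_cons, List.cons_append, List.nil_append]; ring)
  have hp : ∀ i j k F, (allEnds (crossing (x₂, j) (u₂, i) (u₁, !j) (x₁, !i) ::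
      crossing (x₃, k) (y₃, i) (v, !k) (u₂, !i) :: crossing (v, k) (y₂, !j) (y₁, !k) (u₁, j) ::
      F)).Perm ((u₁, j) :: (u₁, !j) :: (u₂, i) :: (u₂, !i) :: (v, k) :: (v, !k) ::
        ([(x₁, !i), (x₂, j), (x₃, k), (y₁, !k), (y₂, !j), (y₃, i)] ++ allEnds F)) := by
    intro i j k F
    rw [List.perm_iff_count]; intro a
    simp only [allEnds_crossing_cons, List.count_cons, List.cons_append, List.nil_append]; ring
  have hp' : ∀ i j k F, (allEnds (crossing (x₃, k) (s₃, !j) (s₂, !k) (x₂, j) ::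
      crossing (s₂, k) (w, i) (y₁, !k) (x₁, !i) :: crossing (s₃, j) (y₃, i) (y₂, !j) (w, !i) ::
      F)).Perm ((s₂, k) :: (s₂, !k) :: (s₃, j) :: (s₃, !j) :: (w, i) :: (w, !i) ::
        ([(x₁, !i), (x₂, j), (x₃, k), (y₁, !k), (y₂, !j), (y₃, i)] ++ allEnds F)) := by
    intro i j k F
    rw [List.perm_iff_count]; intro a
    simp only [allEnds_crossing_cons, List.count_cons, List.cons_append, List.nil_append]; ring
  have hc : ∀ i j k F, List.Forall₂ Lifts F D → _ := fun i j k F hFD =>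
    (isTangle_r3'_left t i j k hu.1 hu.2.1 hu.2.2 hO).card_colorings_eq
      (isTangle_r3'_right t i j k hs.1 hs.2.1 hs.2.2 hO') (F := F)
      (fun x hx => ⟨hO x hx, hO' x hx⟩) (fun e he => ⟨hF F hFD e he, hF' F hFD e he⟩)
  refine colorCounts_eq t (fun E hE => ?_) fun E hE => ?_
  · obtain ⟨j, i, F, rfl, hE, hn⟩ := isOrientation_crossing_cons.1 hE
    simp only [List.forall₂_cons_right_iff, lifts_crossing] at hE
    obtain ⟨_, _, ⟨k, i', rfl⟩, ⟨_, F, ⟨k', j', rfl⟩, hFD, rfl⟩, rfl⟩ := hE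
    obtain rfl : i' = i := by simpa using eq_not_of_nodup hn 1 7 (by simp) rfl rfl
    obtain rfl : j' = !j := by simpa using eq_not_of_nodup hn 2 11 (by simp) rfl rfl
    obtain rfl : k' = k := by simpa using eq_not_of_nodup hn 6 8 (by simp) rfl rfl
    rw [Bool.not_not] at hn ⊢
    refine ⟨_, isOrientation_three (lifts_crossing.2 ⟨k', !j, by rw [Bool.not_not]⟩)
      (lifts_crossing.2 ⟨k', i', rfl⟩)
      (lifts_crossing.2 ⟨j, i', rfl⟩) hFD ?_, hc i' j k' F hFD⟩
    refine nodup_of_perm (hp' _ _ _ _) hs hO' (hF' F hFD) (nodup_of_nodup_of_perm (hp _ _ _ _) hn)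
  · obtain ⟨k, j, F, rfl, hE, hn⟩ := isOrientation_crossing_cons.1 hE
    simp only [List.forall₂_cons_right_iff, lifts_crossing] at hE
    obtain ⟨_, _, ⟨k', i, rfl⟩, ⟨_, F, ⟨j', i', rfl⟩, hFD, rfl⟩, rfl⟩ := hE
    obtain rfl : j = !j' := by simpa using eq_not_of_nodup hn 8 1 (by simp) rfl rfl
    obtain rfl : k' = k := by simpa using eq_not_of_nodup hn 2 4 (by simp) rfl rfl
    obtain rfl : i' = i := by
      rw [← Bool.not_inj_iff]
      exact eq_not_of_nodup hn 5 11 (by simp) rfl rfl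
    rw [Bool.not_not] at hn ⊢
    refine ⟨_, isOrientation_three (lifts_crossing.2 ⟨j', i', rfl⟩) (lifts_crossing.2 ⟨k', i', rfl⟩)
      (lifts_crossing.2 ⟨k', !j', by rw [Bool.not_not]⟩) hFD ?_, hc i' j' k' F hFD⟩
    refine nodup_of_perm (hp _ _ _ _) hu hO (hF F hFD) (nodup_of_nodup_of_perm (hp' _ _ _ _) hn)

omit [DecidableEq L] in
theorem _root_.Item.colored_map {t : Rˣ} {f : L → R} {g : L → L} {i : Item (L × Bool)} :
    (i.map (Prod.map g id)).Colored t f ↔ i.Colored t (f ∘ g) := by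
  cases i <;> rfl

omit [DecidableEq L] in
theorem forall₂_lifts_map_iff {E : DiagramCode (L × Bool)} {D : DiagramCode L} (g : L → L) :
    List.Forall₂ Lifts E (D.map (Item.map g)) ↔
      ∃ F : DiagramCode (L × Bool), List.Forall₂ Lifts F D ∧
        E = F.map (Item.map (Prod.map g id)) := by
  induction D generalizing E with
  | nil => simp
  | cons d D ih =>
    have hd : ∀ i : Item (L × Bool), i.Lifts (d.map g) ↔
        ∃ i' : Item (L × Bool), i'.Lifts d ∧ i = i'.map (Prod.map g id) := by
      intro i
      rcases d with ⟨a, b⟩ | ⟨a, b, c, d⟩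
      · simp only [Item.map, lifts_strand]
        constructor
        · rintro ⟨j, rfl⟩
          exact ⟨_, ⟨j, rfl⟩, rfl⟩
        · rintro ⟨_, ⟨j, rfl⟩, rfl⟩
          exact ⟨j, rfl⟩
      · simp only [Item.map, lifts_crossing]
        constructor
        · rintro ⟨j, k, rfl⟩
          exact ⟨_, ⟨j, k, rfl⟩, rfl⟩
        · rintro ⟨_, ⟨j, k, rfl⟩, rfl⟩
          exact ⟨j, k, rfl⟩
    simp only [List.map_cons, List.forall₂_cons_right_iff, hd, ih]
    constructor
    · rintro ⟨_, _, ⟨i, hi, rfl⟩, ⟨F, hF, rfl⟩, rfl⟩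
      exact ⟨i :: F, ⟨i, F, hi, hF, rfl⟩, rfl⟩
    · rintro ⟨_, ⟨i, F, hi, hF, rfl⟩, rfl⟩
      exact ⟨_, _, ⟨i, hi, rfl⟩, ⟨F, hF, rfl⟩, rfl⟩

/-- The colour of `b` is a copy of that of `a`, so nothing is lost by merging them. The hypothesis
`hb` ensures that `a` still occurs afterwards; otherwise its colour would be forced to 0. -/
theorem card_colorings_absorb (t : Rˣ) {a b : L} {j : Bool} (hab : a ≠ b)
    {F : DiagramCode (L × Bool)} (hb : ∃ e ∈ F.allEnds, e.1 = b) :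
    Nat.card (colorings t (strand (a, j) (b, !j) :: F)) =
      Nat.card (colorings t
        (F.map (Item.map (Prod.map (fun x => if x = b then a else x) id)))) := by
  have hends : ∀ x, (∀ e ∈ allEnds (F.map (Item.map
      (Prod.map (fun x => if x = b then a else x) id))), e.1 ≠ x) ↔
      ∀ e ∈ F.allEnds, (if e.1 = b then a else e.1) ≠ x := by
    intro x
    simp only [allEnds_map, List.forall_mem_map, Prod.map_fst]
  have hcol : ∀ f : L → R, (∀ i ∈ F.map (Item.map
      (Prod.map (fun x => if x = b then a else x) id)), i.Colored t f) ↔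
      ∀ i ∈ F, i.Colored t (f ∘ fun x => if x = b then a else x) := by
    intro f
    simp only [List.forall_mem_map, colored_map]
  refine card_colorings_eq t {b} ?_ ?_ ?_ ?_
  · rintro f ⟨h1, h2⟩
    simp only [List.forall_mem_cons, allEnds_strand_cons] at h1 h2
    refine ⟨fun x => if x = b then 0 else f x, ⟨?_, ?_⟩, fun x hx => if_neg hx⟩
    · rw [hcol]
      intro i hi
      convert h1.2 i hi using 1
      funext x
      by_cases hx : x = b
      · have h1' : f a = f b := h1.1
        simp [hx, hab, h1']
      · simp [hx]
    · intro x hx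
      rw [hends] at hx
      dsimp only
      split_ifs with hxb
      · rfl
      obtain ⟨e, he, heb⟩ := hb
      have hxa : a ≠ x := by simpa [heb] using hx e he
      refine h2 x ⟨hxa, Ne.symm hxb, fun e he => ?_⟩
      rintro rfl
      exact hx e he (if_neg hxb)
  · rintro f ⟨h1, h2⟩
    rw [hcol] at h1
    refine ⟨f ∘ fun x => if x = b then a else x, ⟨?_, ?_⟩, fun x hx => ?_⟩
    · refine List.forall_mem_cons.2 ⟨?_, h1⟩
      simp [Colored, hab]
    · intro x hx
      simp only [List.forall_mem_cons, allEnds_strand_cons] at hx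
      rw [Function.comp_apply, if_neg hx.2.1.symm]
      refine h2 x ((hends x).2 fun e he => ?_)
      split_ifs
      · exact hx.1
      · exact hx.2.2 e he
    · exact congrArg f (if_neg hx)
  · rintro f ⟨h1, h2⟩ g ⟨h3, h4⟩ hfg
    simp only [List.forall_mem_cons, Colored] at h1 h3
    ext x
    by_cases hx : x = b
    · rw [hx, ← h1.1, ← h3.1, hfg a hab]
    · exact hfg x hx
  · rintro f ⟨h1, h2⟩ g ⟨h3, h4⟩ hfg
    ext x
    by_cases hx : x = b
    · have : ∀ e ∈ F.allEnds, (if e.1 = b then a else e.1) ≠ x := by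
        intro e he
        split_ifs with h
        · exact hx ▸ hab
        · exact hx ▸ h
      rw [h2 x ((hends x).2 this), h4 x ((hends x).2 this)]
    · exact hfg x hx

theorem colorCounts_absorb (t : Rˣ) (a b : L) (hab : a ≠ b) (D : DiagramCode L)
    (h : Glued (strand a b :: D)) :
    colorCounts t (strand a b :: D) =
      colorCounts t (D.map (Item.map fun x => if x = b then a else x)) := by
  have hca := h a (by simp)
  have hcb := h b (by simp)
  simp only [allEnds_strand_cons, List.count_cons, BEq.rfl, if_true, beq_iff_eq, hab, hab.symm,
    if_false] at hca hcb
  have hmem : ∀ (F : DiagramCode (L × Bool)), List.Forall₂ Lifts F D → ∀ x ∈ D.allEnds,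
      ∃ k, (x, k) ∈ F.allEnds := by
    intro F hF x hx
    rw [← allEnds_lift hF, List.mem_map] at hx
    obtain ⟨⟨_, k⟩, he, rfl⟩ := hx
    exact ⟨k, he⟩
  have ha' : a ∈ D.allEnds := List.count_pos_iff.1 (by omega)
  have hb' : b ∈ D.allEnds := List.count_pos_iff.1 (by omega)
  refine colorCounts_eq t (fun E hE => ?_) fun E hE => ?_
  · obtain ⟨j, F, rfl, hF, hn⟩ := isOrientation_strand_cons.1 hE
    obtain ⟨k, hk⟩ := hmem F hF b hb'
    refine ⟨_, ⟨(forall₂_lifts_map_iff _).2 ⟨F, hF, rfl⟩, ?_⟩,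
      card_colorings_absorb t hab ⟨_, hk, rfl⟩⟩
    rw [allEnds_map]
    simp only [allEnds_strand_cons, List.nodup_cons, List.mem_cons, not_or] at hn
    refine List.Nodup.map_on ?_ hn.2.2
    rintro ⟨x, c⟩ hx ⟨y, d⟩ hy hxy
    simp only [Prod.map_apply, id_eq, Prod.mk.injEq] at hxy
    obtain ⟨hxy, rfl⟩ := hxy
    rcases Bool.eq_or_eq_not c j with rfl | rfl <;> split_ifs at hxy <;> simp_all
  · obtain ⟨hE, hn⟩ := hE
    obtain ⟨F, hF, rfl⟩ := (forall₂_lifts_map_iff _).1 hE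
    obtain ⟨k, hk⟩ := hmem F hF a ha'
    obtain ⟨l, hl⟩ := hmem F hF b hb'
    rw [allEnds_map] at hn
    -- The ends at `a` and `b` become the two ends of one label, hence have opposite bits, as the
    -- arc between them requires.
    obtain rfl : l = !k := by
      by_contra hlk
      obtain rfl : l = k := by simpa using hlk
      exact hab (congrArg Prod.fst (List.inj_on_of_nodup_map hn hk hl (by simp)))
    -- The arc uses up one of the two ends at `a` and at `b`, so `D` has only one end left at each
    -- and the complementary bit is free for the arc.
    have huniq : ∀ x ∈ D.allEnds, D.allEnds.count x = 1 → ∀ k, (x, k) ∈ F.allEnds →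
        (x, !k) ∉ F.allEnds := by
      intro x hx hc k hk hk'
      obtain ⟨l', hp, hs⟩ : [(x, k), (x, !k)].Subperm F.allEnds :=
        List.subperm_of_subset (by simp) (by
        rintro e he
        simp only [List.mem_cons, List.not_mem_nil, or_false] at he
        rcases he with rfl | rfl <;> assumption)
      have := (hs.map Prod.fst).count_le x
      rw [allEnds_lift hF, hc, (hp.map Prod.fst).count_eq] at this
      simp at this
    refine ⟨_, isOrientation_strand_cons.2 ⟨!k, F, rfl, hF, ?_⟩,
      card_colorings_absorb t hab ⟨_, hl, rfl⟩⟩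
    simp only [allEnds_strand_cons, List.nodup_cons, List.mem_cons, not_or]
    refine ⟨⟨by simp [hab], huniq a ha' (by omega) k hk⟩, huniq b hb' (by omega) _ hl, ?_⟩
    exact List.Nodup.of_map _ hn

theorem Move.colorCounts_eq (t : Rˣ) {D D' : DiagramCode L} (h : Move D D') (hD : D.Glued)
    (hD' : D'.Glued) : colorCounts t D = colorCounts t D' := by
  cases h with
  | perm _ _ h => exact colorCounts_perm t h
  | flip => exact colorCounts_flip t _ _ _
  | rotate => exact colorCounts_rotate t _ _ _ _ _
  | absorb _ _ hab => exact colorCounts_absorb t _ _ hab _ hD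
  | r1 => exact colorCounts_r1 t _ _ _ _ hD
  | r1' => exact colorCounts_r1' t _ _ _ _ hD
  | r2 => exact colorCounts_r2 t _ _ _ _ _ _ _ hD
  | r3 => exact colorCounts_r3 t _ _ _ _ _ _ _ _ _ _ _ _ _ hD hD'
  | r3' => exact colorCounts_r3' t _ _ _ _ _ _ _ _ _ _ _ _ _ hD hD'

/-- The numbers of colourings are invariants of unoriented links. -/
theorem SameKnot.colorCounts_eq (t : Rˣ) {D D' : DiagramCode L} (h : SameKnot D D') :
    colorCounts t D = colorCounts t D' := by
  induction h with
  | rel _ _ h => exact h.2.2.colorCounts_eq t h.1.1 h.2.1.1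
  | refl => rfl
  | symm _ _ _ ih => exact ih.symm
  | trans _ _ _ _ _ ih ih' => exact ih.trans ih'

end DiagramCode

/-! ### Orientations of one code differ by a bit at each label -/

namespace List

/-- Two ways to mark the entries of a list with bits such that equal entries are told apart differ
by a function of the entries. -/
theorem exists_eq_map_xor_of_nodup {L : Type} {l₁ l₂ : List (L × Bool)} (h₁ : l₁.Nodup)
    (h₂ : l₂.Nodup) (h : l₁.map Prod.fst = l₂.map Prod.fst) :
    ∃ ℓ : L → Bool, l₁ = l₂.map fun e => (e.1, xor e.2 (ℓ e.1)) := by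
  classical
  have hlen : l₁.length = l₂.length := by simpa using congrArg length h
  have hfst : ∀ k (hk : k < l₁.length), l₁[k].1 = (l₂[k]'(hlen ▸ hk)).1 := by
    intro k hk
    have := congrArg (fun l => l[k]?) h
    simpa [hk, hlen ▸ hk] using this
  -- The bit at `x` records whether the two markings disagree at some entry `x`. They then disagree
  -- at every such entry, since the bits of two equal entries are opposite in both lists.
  refine ⟨fun x => decide (∃ k, ∃ hk : k < l₁.length, l₁[k].1 = x ∧
    l₁[k].2 ≠ (l₂[k]'(hlen ▸ hk)).2), ext_getElem (by simpa using hlen) fun k hk _ => ?_⟩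
  rw [getElem_map]
  refine Prod.ext (hfst k hk) ?_
  dsimp only
  by_cases hx : ∃ k', ∃ hk' : k' < l₁.length, l₁[k'].1 = (l₂[k]'(hlen ▸ hk)).1 ∧
    l₁[k'].2 ≠ (l₂[k']'(hlen ▸ hk')).2
  · rw [decide_eq_true hx]
    obtain ⟨k', hk', h1, h2⟩ := hx
    rw [← hfst k hk] at h1
    by_cases hkk : k' = k
    · subst hkk
      revert h2
      cases l₁[k'].2 <;> cases (l₂[k']'(hlen ▸ hk')).2 <;> simp
    · have h3 : l₁[k'].2 ≠ l₁[k].2 := fun h3 =>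
        hkk (h₁.getElem_inj_iff.1 (Prod.ext h1 h3))
      have h4 : (l₂[k']'(hlen ▸ hk')).2 ≠ (l₂[k]'(hlen ▸ hk)).2 := fun h4 =>
        hkk (h₂.getElem_inj_iff.1 (Prod.ext (by rw [← hfst k' hk', ← hfst k hk, h1]) h4))
      revert h2 h3 h4
      cases l₁[k'].2 <;> cases (l₂[k']'(hlen ▸ hk')).2 <;> cases l₁[k].2 <;>
        cases (l₂[k]'(hlen ▸ hk)).2 <;> simp
  · rw [decide_eq_false hx, Bool.xor_false]
    by_contra h3
    exact hx ⟨k, hk, hfst k hk, h3⟩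

end List

namespace DiagramCode

open Item

variable {L : Type}

/-- Change the bits at the ends by a function of the labels. -/
def orient (ℓ : L → Bool) (U : DiagramCode (L × Bool)) : DiagramCode (L × Bool) :=
  U.map (Item.map fun e => (e.1, xor e.2 (ℓ e.1)))

/-- The number of ends tells arcs from crossings, so the concatenated list can be cut back into its
pieces. -/
theorem eq_of_allEnds_eq {E E' : DiagramCode L}
    (h : E.allEnds = E'.allEnds) (hl : List.Forall₂ (fun i j => i.ends.length = j.ends.length)
      E E') :
    E = E' := by
  induction hl with
  | nil => rfl
  | cons hi _ ih =>
    rename_i i j E E' _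
    simp only [allEnds, List.flatMap_cons] at h
    obtain ⟨h1, h2⟩ := List.append_inj h hi
    rw [ih h2]
    congr 1
    cases i <;> cases j <;> simp_all [ends]

/-- The marking `U` need not be an orientation; any way of telling glued ends apart serves as a
reference. An orientation thereby becomes a function on labels. -/
theorem exists_eq_orient {E U : DiagramCode (L × Bool)} (hE : E.allEnds.Nodup)
    (hU : U.allEnds.Nodup) (h : E.map forget = U.map forget) : ∃ ℓ, E = U.orient ℓ := by
  have hfst : ∀ V : DiagramCode (L × Bool), V.allEnds.map Prod.fst = allEnds (V.map forget) := by
    intro V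
    simp [allEnds, List.map_flatMap, List.flatMap_map, ends_forget]
  obtain ⟨ℓ, hℓ⟩ := List.exists_eq_map_xor_of_nodup hE hU (by rw [hfst, hfst, h])
  refine ⟨ℓ, eq_of_allEnds_eq (by rw [hℓ, orient, allEnds_map]) ?_⟩
  have : List.Forall₂ (fun i j : Item (L × Bool) => i.forget = j.forget) E U := by
    rw [← List.forall₂_eq_eq_eq, List.forall₂_map_left_iff, List.forall₂_map_right_iff] at h
    exact h
  rw [orient, List.forall₂_map_right_iff]
  refine this.imp fun i j hij => ?_
  cases i <;> cases j <;> simp_all [forget, ends, Item.map]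

end DiagramCode

/-! ### The two orientations of the diagram with even labels -/

/-- The edges of the tree `T'`. -/
def TreeEdge.outer : TreeEdge → Bool
  | p | q | r => false
  | a | b | c => true

namespace Girth3

open Item DiagramCode TreeEdge

/-- A row of half twists, where the bits tell the upper ends from the lower ends. -/
def twistEnds (e : TreeEdge) (n : ℤ) : DiagramCode (CutPoint × Bool) :=
  (List.range n.natAbs).map fun j =>
    if 0 < n then crossing (lt e j, false) (rt e j, false) (rt e (j + 1), true) (lt e (j + 1), true)
    else crossing (rt e j, false) (rt e (j + 1), true) (lt e (j + 1), true) (lt e j, false)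

/-- The arcs of the diagram between the rows of half twists. -/
def arcEnds (n : TreeEdge → ℤ) : DiagramCode (CutPoint × Bool) :=
  [ strand (lt p 0, true) (rt q 0, true), strand (lt q 0, true) (rt r 0, true),
    strand (lt r 0, true) (rt p 0, true), strand (lt a 0, true) (rt c 0, true),
    strand (lt b 0, true) (rt a 0, true), strand (lt c 0, true) (rt b 0, true),
    strand (lt p (n p).natAbs, false) (lt a (n a).natAbs, false),
    strand (rt q (n q).natAbs, false) (rt a (n a).natAbs, false),
    strand (lt q (n q).natAbs, false) (lt b (n b).natAbs, false),
    strand (rt r (n r).natAbs, false) (rt b (n b).natAbs, false),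
    strand (lt r (n r).natAbs, false) (lt c (n c).natAbs, false),
    strand (rt p (n p).natAbs, false) (rt c (n c).natAbs, false) ]

/-- The diagram, where the two ends at every cut point are told apart by bits. -/
def KEnds (n : TreeEdge → ℤ) : DiagramCode (CutPoint × Bool) :=
  ([p, q, r, a, b, c].flatMap fun e => twistEnds e (n e)) ++ arcEnds n

theorem twistEnds_map_forget (e : TreeEdge) (n : ℤ) : (twistEnds e n).map forget = twist e n := by
  simp only [twistEnds, twist, List.map_map]
  refine List.map_congr_left fun j _ => ?_
  simp only [Function.comp_apply]
  split_ifs <;> rfl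

theorem KEnds_map_forget (n : TreeEdge → ℤ) :
    (KEnds n).map forget = K (n p) (n q) (n r) (n a) (n b) (n c) := by
  simp [KEnds, K, arcEnds, forget, twistEnds_map_forget]

/-- The strict bounds separate rows from arcs: in a row the bit `true` excludes level 0 and `false`
excludes the last level, which are the levels where the arcs use these bits. -/
theorem mem_allEnds_twistEnds {e : TreeEdge} {n : ℤ} {z : CutPoint × Bool}
    (hz : z ∈ (twistEnds e n).allEnds) : z.1.edge = e ∧ z.1.level ≤ n.natAbs ∧
      if z.2 then 1 ≤ z.1.level else z.1.level < n.natAbs := by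
  simp only [allEnds, twistEnds, List.flatMap_map, List.mem_flatMap, List.mem_range] at hz
  obtain ⟨j, hj, hz⟩ := hz
  split_ifs at hz <;> simp only [ends, List.mem_cons, List.not_mem_nil, or_false] at hz <;>
    rcases hz with rfl | rfl | rfl | rfl <;> simp [lt, rt] <;> omega

theorem nodup_allEnds_twistEnds (e : TreeEdge) (n : ℤ) : (twistEnds e n).allEnds.Nodup := by
  simp only [allEnds, twistEnds, List.flatMap_map]
  refine List.nodup_flatMap.2 ⟨fun j _ => ?_, ?_⟩
  · split_ifs <;> simp [ends, lt, rt]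
  · refine List.nodup_range.imp fun {j k} hjk => ?_
    rw [Function.onFun, List.disjoint_left]
    intro z hz hz'
    split_ifs at hz hz' <;>
      simp only [ends, List.mem_cons, List.not_mem_nil, or_false] at hz hz' <;>
      rcases hz with rfl | rfl | rfl | rfl <;> simp [lt, rt] at hz' <;> omega

theorem mem_allEnds_arcEnds {n : TreeEdge → ℤ} {z : CutPoint × Bool}
    (hz : z ∈ (arcEnds n).allEnds) :
    z.1.level = if z.2 then 0 else (n z.1.edge).natAbs := by
  revert z
  simp only [arcEnds, allEnds_strand_cons, allEnds_nil, List.forall_mem_cons]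
  simp [lt, rt]

theorem nodup_allEnds_KEnds (n : TreeEdge → ℤ) : (KEnds n).allEnds.Nodup := by
  rw [KEnds, allEnds_append, List.nodup_append]
  have h : allEnds ([p, q, r, a, b, c].flatMap fun e => twistEnds e (n e)) =
      [p, q, r, a, b, c].flatMap fun e => (twistEnds e (n e)).allEnds := by
    simp [allEnds]
  rw [h]
  refine ⟨List.nodup_flatMap.2 ⟨fun e _ => nodup_allEnds_twistEnds e _, ?_⟩, ?_, ?_⟩
  · have : [p, q, r, a, b, c].Nodup := by decide
    refine this.imp fun {e e'} hee => ?_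
    rw [Function.onFun, List.disjoint_left]
    intro z hz hz'
    exact hee ((mem_allEnds_twistEnds hz).1.symm.trans (mem_allEnds_twistEnds hz').1)
  · refine List.Nodup.of_map (fun z => (z.1.edge, z.1.left, z.2)) ?_
    simp only [arcEnds, allEnds_strand_cons, allEnds_nil, List.map_cons, List.map_nil, lt, rt]
    decide
  · rintro z hz _ hz' rfl
    obtain ⟨e, -, hz⟩ := List.mem_flatMap.1 hz
    obtain ⟨rfl, -, h1⟩ := mem_allEnds_twistEnds hz
    have h2 := mem_allEnds_arcEnds hz'
    split_ifs at h1 h2 <;> omega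

/-- The two orientations of the diagram: whether the strand through a cut point is directed away
from level `0`. -/
def direction (s : Bool) (x : CutPoint) : Bool :=
  xor s (xor (xor x.left x.edge.outer) x.level.bodd)

theorem forall_mem_KEnds {n : TreeEdge → ℤ} {P : Item (CutPoint × Bool) → Prop} :
    (∀ i ∈ KEnds n, P i) ↔ (∀ e, ∀ i ∈ twistEnds e (n e), P i) ∧ ∀ i ∈ arcEnds n, P i := by
  simp only [KEnds, List.forall_mem_append, List.mem_flatMap, forall_exists_index, and_imp]
  refine and_congr_left fun _ => ⟨fun h e i hi => h i e (by cases e <;> simp) hi,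
    fun h i e _ hi => h e i hi⟩

theorem directed_orient_direction {n : TreeEdge → ℤ} (hn : ∀ e, Even (n e)) (s : Bool) :
    ∀ i ∈ (KEnds n).orient (direction s), Item.Directed i := by
  simp only [orient, List.forall_mem_map]
  refine forall_mem_KEnds.2 ⟨fun e => ?_, ?_⟩
  · simp only [twistEnds, List.forall_mem_map]
    intro j _
    split_ifs <;> simp [Item.map, Item.Directed, direction, lt, rt]
  -- Evenness enters here: each strand returns to its original side at the far end of its row, so
  -- the antiparallel directions fit the arcs in the triangles.
  · have h : ∀ e, (n e).natAbs.bodd = false := by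
      intro e
      obtain ⟨k, hk⟩ := Int.natAbs_even.2 (hn e)
      simp [hk]
    simp [arcEnds, Item.map, Item.Directed, direction, lt, rt, outer, h]

theorem isOrientation_orient_direction {n : TreeEdge → ℤ} (hn : ∀ e, Even (n e)) (s : Bool) :
    ((KEnds n).orient (direction s)).IsOrientation (K (n p) (n q) (n r) (n a) (n b) (n c)) := by
  refine ⟨?_, ?_⟩
  · have hd := directed_orient_direction hn s
    have hf : ((KEnds n).orient (direction s)).map forget =
        K (n p) (n q) (n r) (n a) (n b) (n c) := by
      rw [← KEnds_map_forget, orient, List.map_map]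
      refine List.map_congr_left fun i _ => ?_
      cases i <;> rfl
    rw [← hf, List.forall₂_map_right_iff, List.forall₂_same]
    exact fun i hi => ⟨rfl, hd i hi⟩
  · rw [orient, allEnds_map]
    refine (nodup_allEnds_KEnds n).map ?_
    rintro ⟨x, u⟩ ⟨y, v⟩ h
    simp only [Prod.mk.injEq] at h
    obtain ⟨rfl, h⟩ := h
    simpa using h

theorem level_le_of_mem_allEnds_KEnds {n : TreeEdge → ℤ} {z : CutPoint × Bool}
    (hz : z ∈ (KEnds n).allEnds) : z.1.level ≤ (n z.1.edge).natAbs := by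
  rw [KEnds, allEnds_append, List.mem_append] at hz
  rcases hz with hz | hz
  · obtain ⟨i, hi, hz⟩ := List.mem_flatMap.1 hz
    obtain ⟨e, -, hi⟩ := List.mem_flatMap.1 hi
    obtain ⟨rfl, h, -⟩ := mem_allEnds_twistEnds (mem_allEnds_of_mem hi hz)
    exact h
  · rw [mem_allEnds_arcEnds hz]
    split_ifs <;> simp

/-- Directions propagate through the rows and the twelve arcs, so the bit at a single cut point
determines all others. -/
theorem eq_direction_of_directed {n : TreeEdge → ℤ} (hn : ∀ e, Even (n e)) {ℓ : CutPoint → Bool}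
    (h : ∀ i ∈ (KEnds n).orient ℓ, Item.Directed i) :
    ∃ s, ∀ x : CutPoint, x.level ≤ (n x.edge).natAbs → ℓ x = direction s x := by
  simp only [orient, List.forall_mem_map] at h
  obtain ⟨h1, h2⟩ := forall_mem_KEnds.1 h
  -- Each half twist exchanges left and right, so a strand is traced back to level 0 by the parity
  -- of its level.
  have h3 : ∀ e l j, j ≤ (n e).natAbs → ℓ ⟨e, l, j⟩ = ℓ ⟨e, xor l j.bodd, 0⟩ := by
    intro e l j
    induction j generalizing l with
    | zero => simp
    | succ j ih =>
      intro hj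
      have h4 := h1 e
      simp only [twistEnds, List.forall_mem_map, List.mem_range] at h4
      have h5 : ∀ l, ℓ ⟨e, l, j + 1⟩ = ℓ ⟨e, !l, j⟩ := by
        have := h4 j (by omega)
        revert this
        split_ifs <;> simp only [Item.map, Item.Directed, lt, rt, Bool.false_xor,
          Bool.true_xor, Bool.not_inj_iff, Bool.not_not] <;> rintro ⟨h6, h7⟩ (_ | _) <;> simp_all
      rw [h5, ih _ (by omega)]
      simp
  have h4 : ∀ e l, ℓ ⟨e, l, (n e).natAbs⟩ = ℓ ⟨e, l, 0⟩ := by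
    intro e l
    obtain ⟨k, hk⟩ := Int.natAbs_even.2 (hn e)
    rw [h3 e l _ le_rfl]
    simp [hk]
  have h5 : ∀ e l, ℓ ⟨e, l, 0⟩ = xor (!ℓ ⟨p, true, 0⟩) (xor l e.outer) := by
    simp only [arcEnds, List.forall_mem_cons, Item.map, Item.Directed, lt, rt, h4, Bool.true_xor,
      Bool.false_xor, Bool.not_not] at h2
    obtain ⟨e1, e2, e3, e4, e5, e6, e7, e8, e9, e10, e11, e12, -⟩ := h2
    have : ∀ l, xor l true = !l := by simp
    rintro (_ | _ | _ | _ | _ | _) (_ | _) <;> simp [outer] <;> grind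
  refine ⟨!ℓ ⟨p, true, 0⟩, fun x hx => ?_⟩
  obtain ⟨e, l, j⟩ := x
  rw [h3 e l j hx, h5, direction]
  simp only [Bool.xor_assoc, Bool.xor_comm e.outer]

theorem isOrientation_K_iff {n : TreeEdge → ℤ} (hn : ∀ e, Even (n e))
    {E : DiagramCode (CutPoint × Bool)} :
    E.IsOrientation (K (n p) (n q) (n r) (n a) (n b) (n c)) ↔
      ∃ s, E = (KEnds n).orient (direction s) := by
  constructor
  · rintro ⟨h1, h2⟩
    have hf : E.map forget = (KEnds n).map forget := by
      rw [KEnds_map_forget, ← List.forall₂_eq_eq_eq, List.forall₂_map_left_iff]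
      exact h1.imp fun _ _ h => h.1
    have hd : ∀ i ∈ E, Item.Directed i := by
      clear h2 hf
      generalize K (n p) (n q) (n r) (n a) (n b) (n c) = D at h1
      induction h1 with
      | nil => simp
      | cons h _ ih => exact List.forall_mem_cons.2 ⟨h.2, ih⟩
    obtain ⟨ℓ, rfl⟩ := exists_eq_orient h2 (nodup_allEnds_KEnds n) hf
    obtain ⟨s, hs⟩ := eq_direction_of_directed hn hd
    refine ⟨s, List.map_congr_left fun i hi => ?_⟩
    have hl : ∀ z ∈ i.ends, ℓ z.1 = direction s z.1 := fun z hz =>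
      hs _ (level_le_of_mem_allEnds_KEnds (mem_allEnds_of_mem hi hz))
    cases i <;> simp_all [Item.map, ends]
  · rintro ⟨s, rfl⟩
    exact isOrientation_orient_direction hn s

end Girth3

/-! ### Reduction of the colourings to a 2 × 2 linear system -/

namespace Girth3

open Item DiagramCode TreeEdge

variable {R : Type*} [CommRing R]

/-- The effect of a half twist on the colours of the two strands. -/
def twistStep (pos : Prop) [Decidable pos] (w : R) (x : R × R) : R × R :=
  if pos then (x.2, x.2 + w * (x.1 - x.2)) else (x.1 + w * (x.2 - x.1), x.1)

/-- The colours of the two strands after `j` half twists. -/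
def twistColors (t : Rˣ) (β : Bool) (pos : Prop) [Decidable pos] (x : R × R) : ℕ → R × R
  | 0 => x
  | j + 1 => twistStep pos (weight t (xor β j.bodd)) (twistColors t β pos x j)

/-- The two half twists of a full twist have inverse multipliers. Together they preserve the
difference of the colours and shift both by the same multiple of it, so full twists simply add up.
-/
theorem twistColors_two_mul (t : Rˣ) (β : Bool) (pos : Prop) [Decidable pos] (x : R × R) (k : ℕ) :
    twistColors t β pos x (2 * k) =
      (x.1 + (if pos then (k : R) else -k) * (weight t β - 1) * (x.1 - x.2),
       x.2 + (if pos then (k : R) else -k) * (weight t β - 1) * (x.1 - x.2)) := by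
  have hw := weight_mul_weight_not t β
  induction k with
  | zero => simp [twistColors]
  | succ k ih =>
    have h : twistColors t β pos x (2 * (k + 1)) = twistStep pos (weight t (!β))
        (twistStep pos (weight t β) (twistColors t β pos x (2 * k))) := by
      rw [mul_add, mul_one, twistColors, twistColors]
      simp
    rw [h, ih]
    by_cases hp : pos
    · simp only [twistStep, if_pos hp, Nat.cast_add, Nat.cast_one, Prod.mk.injEq]
      constructor
      · ring
      · linear_combination (-(x.1 - x.2)) * hw
    · simp only [twistStep, if_neg hp, Nat.cast_add, Nat.cast_one, Prod.mk.injEq]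
      constructor
      · linear_combination (x.1 - x.2) * hw
      · ring

theorem twistColors_natAbs (t : Rˣ) (β : Bool) (x : R × R) (k : ℤ) :
    twistColors t β (0 < 2 * k) x (2 * k).natAbs =
      (x.1 + k * (weight t β - 1) * (x.1 - x.2), x.2 + k * (weight t β - 1) * (x.1 - x.2)) := by
  rw [Int.natAbs_mul, show (2 : ℤ).natAbs = 2 from rfl, twistColors_two_mul]
  have : (if 0 < 2 * k then (k.natAbs : R) else -(k.natAbs : R)) = k := by
    split_ifs with h
    · obtain ⟨m, rfl⟩ := Int.eq_ofNat_of_zero_le (show 0 ≤ k by omega)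
      simp
    · obtain ⟨m, hm⟩ := Int.eq_ofNat_of_zero_le (show 0 ≤ -k by omega)
      obtain rfl : k = -m := by omega
      simp
  rw [this]

/-- The conditions on a colouring at the arcs of the diagram, where `x e` and `y e` are the colours
at both ends of the row of half twists on `e`. -/
def ArcRelations (x y : TreeEdge → R × R) : Prop :=
  (x p).1 = (x q).2 ∧ (x q).1 = (x r).2 ∧ (x r).1 = (x p).2 ∧
  (x a).1 = (x c).2 ∧ (x b).1 = (x a).2 ∧ (x c).1 = (x b).2 ∧
  (y p).1 = (y a).1 ∧ (y q).2 = (y a).2 ∧ (y q).1 = (y b).1 ∧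
  (y r).2 = (y b).2 ∧ (y r).1 = (y c).1 ∧ (y p).2 = (y c).2

/-- For either handedness the end that decides the multiplier is on the right; passing from level
`j` to `j + 1` flips both the reference bit and the parity, so one formula covers both signs. -/
theorem colored_orient_direction_iff (t : Rˣ) (n : TreeEdge → ℤ) (s : Bool) (f : CutPoint → R) :
    (∀ i ∈ (KEnds n).orient (direction s), i.Colored t f) ↔
      (∀ e j, j < (n e).natAbs → (f (lt e (j + 1)), f (rt e (j + 1))) =
        twistStep (0 < n e) (weight t (xor (xor s e.outer) j.bodd)) (f (lt e j), f (rt e j))) ∧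
      ArcRelations (fun e => (f (lt e 0), f (rt e 0)))
        fun e => (f (lt e (n e).natAbs), f (rt e (n e).natAbs)) := by
  simp only [orient, List.forall_mem_map]
  rw [forall_mem_KEnds]
  refine and_congr (forall_congr' fun e => ?_) ?_
  · simp only [twistEnds, List.forall_mem_map, List.mem_range]
    refine forall₂_congr fun j _ => ?_
    split_ifs with h
    · simp only [Item.map, Colored, twistStep, if_pos h, Prod.mk.injEq]
      refine and_congr ⟨fun h => h.symm, fun h => h.symm⟩ ?_
      simp [direction, rt]
    · simp only [Item.map, Colored, twistStep, if_neg h, Prod.mk.injEq]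
      rw [and_comm]
      refine and_congr_left fun h => ?_
      rw [h]
      simp [direction, rt]
  · simp only [arcEnds, List.forall_mem_cons, Item.map, Colored, ArcRelations]
    simp

theorem exists_mem_allEnds_orient_KEnds (ℓ : CutPoint → Bool) {n : TreeEdge → ℤ} {x : CutPoint} :
    (∃ z ∈ ((KEnds n).orient ℓ).allEnds, z.1 = x) ↔ x.level ≤ (n x.edge).natAbs := by
  have h : (∃ z ∈ ((KEnds n).orient ℓ).allEnds, z.1 = x) ↔ ∃ z ∈ (KEnds n).allEnds, z.1 = x := by
    rw [orient, allEnds_map]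
    constructor
    · rintro ⟨_, hz, rfl⟩
      obtain ⟨z, hz', rfl⟩ := List.mem_map.1 hz
      exact ⟨z, hz', rfl⟩
    · rintro ⟨z, hz, rfl⟩
      exact ⟨_, List.mem_map_of_mem hz, rfl⟩
  rw [h]
  constructor
  · rintro ⟨z, hz, rfl⟩
    exact level_le_of_mem_allEnds_KEnds hz
  · obtain ⟨e, l, j⟩ := x
    intro hj
    rcases Nat.lt_or_eq_of_le hj with hj | hj
    · refine ⟨(⟨e, l, j⟩, false), ?_, rfl⟩
      have hi : ∀ i ∈ twistEnds e (n e), i ∈ KEnds n :=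
        (forall_mem_KEnds (P := (· ∈ KEnds n)).1 fun i hi => hi).1 e
      refine mem_allEnds_of_mem (hi _ (List.mem_map_of_mem (List.mem_range.2 hj))) ?_
      split_ifs <;> cases l <;> simp [ends, lt, rt]
    · obtain rfl : j = (n e).natAbs := hj
      refine ⟨(⟨e, l, (n e).natAbs⟩, false), ?_, rfl⟩
      rw [KEnds, allEnds_append, List.mem_append]
      refine Or.inr ?_
      cases e <;> cases l <;> simp [arcEnds, lt, rt]

/-- Colourings are determined by the colours next to level `0`. -/
theorem card_colorings_orient_direction (t : Rˣ) (n : TreeEdge → ℤ) (s : Bool) :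
    Nat.card (colorings t ((KEnds n).orient (direction s))) =
      Nat.card {x : TreeEdge → R × R // ArcRelations x fun e =>
        twistColors t (xor s e.outer) (0 < n e) (x e) (n e).natAbs} := by
  have hT : ∀ f ∈ colorings t ((KEnds n).orient (direction s)), ∀ e j, j ≤ (n e).natAbs →
      (f (lt e j), f (rt e j)) =
        twistColors t (xor s e.outer) (0 < n e) (f (lt e 0), f (rt e 0)) j := by
    intro f hf e j
    induction j with
    | zero => exact fun _ => rfl
    | succ j ih =>
      intro hj
      rw [((colored_orient_direction_iff t n s f).1 hf.1).1 e j hj, ih (by omega), twistColors]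
  have hmem : ∀ x : CutPoint, (∃ z ∈ ((KEnds n).orient (direction s)).allEnds, z.1 = x) ↔
      x.level ≤ (n x.edge).natAbs :=
    fun _ => exists_mem_allEnds_orient_KEnds _
  refine Nat.card_congr (Equiv.ofBijective (fun f => ⟨fun e => (f.1 (lt e 0), f.1 (rt e 0)), ?_⟩)
    ⟨?_, ?_⟩)
  · have h := ((colored_orient_direction_iff t n s f).1 f.2.1).2
    simpa only [hT f.1 f.2 _ _ le_rfl] using h
  · rintro ⟨f, hf⟩ ⟨g, hg⟩ h
    simp only [Subtype.mk.injEq] at h ⊢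
    funext ⟨e, l, j⟩
    by_cases hj : j ≤ (n e).natAbs
    · have h1 := hT f hf e j hj
      rw [congrFun h e, ← hT g hg e j hj] at h1
      cases l
      · exact congrArg Prod.snd h1
      · exact congrArg Prod.fst h1
    · have h1 : ∀ z ∈ ((KEnds n).orient (direction s)).allEnds, z.1 ≠ ⟨e, l, j⟩ := by
        rintro z hz hz'
        exact hj ((hmem ⟨e, l, j⟩).1 ⟨z, hz, hz'⟩)
      rw [hf.2 _ h1, hg.2 _ h1]
  · rintro ⟨x, hx⟩
    let T := fun (y : CutPoint) =>
      twistColors t (xor s y.edge.outer) (0 < n y.edge) (x y.edge) y.level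
    let f : CutPoint → R := fun y =>
      if y.level ≤ (n y.edge).natAbs then (if y.left then (T y).1 else (T y).2) else 0
    have hf : ∀ e j, j ≤ (n e).natAbs → (f (lt e j), f (rt e j)) =
        twistColors t (xor s e.outer) (0 < n e) (x e) j := by
      intro e j hj
      simp [f, T, lt, rt, hj]
    refine ⟨⟨f, (colored_orient_direction_iff t n s f).2 ⟨fun e j hj => ?_, ?_⟩, ?_⟩,
      Subtype.ext (funext fun e => hf e 0 (Nat.zero_le _))⟩
    · rw [hf e _ hj, hf e j hj.le, twistColors]
    · simp only [hf _ _ le_rfl, hf _ _ (Nat.zero_le _)]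
      exact hx
    · intro y hy
      refine if_neg fun h => ?_
      obtain ⟨z, hz, hz'⟩ := (hmem y).2 h
      exact hy z hz hz'

/-- The coefficients of the linear system for the colourings; `k e` is the number of full twists. -/
def systemMatrix (σ : ℤ) (k : TreeEdge → ℤ) : Matrix (Fin 2) (Fin 2) ℤ :=
  !![1 - σ * (k a * k p + k c * k p + k c * k r), -σ * (k c * k r - k a * k q);
     -σ * (k b * k r - k a * k p), 1 - σ * (k b * k q + k b * k r + k a * k q)]

theorem det_systemMatrix (σ : ℤ) (k : TreeEdge → ℤ) : (systemMatrix σ k).det =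
    1 - σ * (k p * (k a + k c) + k q * (k a + k b) + k r * (k b + k c)) +
      σ ^ 2 * ((k p * k q + k q * k r + k r * k p) * (k a * k b + k b * k c + k c * k a)) := by
  rw [systemMatrix, Matrix.det_fin_two_of]
  ring

/-- The factor `Nat.card R` counts the free colour at `p`; the unknowns of the system are the
differences along `p` and `q`. The arcs at the hub make the three differences of `T` add up to 0.
The triangles express the differences on `T'` through those on `T`, and what remains of the triangle
conditions is the two equations. -/
theorem card_arcRelations (t : Rˣ) (k : TreeEdge → ℤ) (s : Bool) (σ : ℤ)
    (hσ : (t + ↑t⁻¹ : R) = 2 - σ) :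
    Nat.card {x : TreeEdge → R × R // ArcRelations x fun e =>
        twistColors t (xor s e.outer) (0 < 2 * k e) (x e) (2 * k e).natAbs} =
      Nat.card R *
        Nat.card {v : Fin 2 → R // ((systemMatrix σ k).map (Int.cast : ℤ → R)).mulVec v = 0} := by
  -- The rows of `T` and of `T'` have inverse multipliers, and (w - 1)(w⁻¹ - 1) = 2 - w - w⁻¹ does
  -- not change when w is inverted; so the orientation `s` drops out.
  have hw : (weight t s - 1 : R) * (weight t (!s) - 1) = σ := by
    have h : (weight t s + weight t (!s) : R) = 2 - σ := by
      rw [← hσ]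
      cases s <;> simp [weight, add_comm]
    linear_combination weight_mul_weight_not t s - h
  rw [← Nat.card_prod]
  obtain ⟨μ, hμ⟩ : ∃ μ, μ = (weight t s - 1 : R) := ⟨_, rfl⟩
  obtain ⟨ν, hν⟩ : ∃ ν, ν = (weight t (!s) - 1 : R) := ⟨_, rfl⟩
  rw [← hμ, ← hν] at hw
  have hx : ∀ x : TreeEdge → R × R, (ArcRelations x fun e =>
      twistColors t (xor s e.outer) (0 < 2 * k e) (x e) (2 * k e).natAbs) ↔
      ArcRelations x fun e => ((x e).1 + k e * (if e.outer then ν else μ) * ((x e).1 - (x e).2),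
        (x e).2 + k e * (if e.outer then ν else μ) * ((x e).1 - (x e).2)) := by
    intro x
    have : (fun e => twistColors t (xor s e.outer) (0 < 2 * k e) (x e) (2 * k e).natAbs) =
        fun e => ((x e).1 + k e * (if e.outer then ν else μ) * ((x e).1 - (x e).2),
          (x e).2 + k e * (if e.outer then ν else μ) * ((x e).1 - (x e).2)) := by
      funext e
      rw [twistColors_natAbs]
      cases h : e.outer <;> simp [hμ, hν]
    rw [this]
  have hσ' : (σ : R) = μ * ν := hw.symm
  have key : ∀ w : Fin 2 → R, ((systemMatrix σ k).map (Int.cast : ℤ → R)).mulVec w = 0 ↔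
      w 0 = μ * ν * ((k a * k p + k c * k p + k c * k r) * w 0 + (k c * k r - k a * k q) * w 1) ∧
      w 1 = μ * ν * ((k b * k r - k a * k p) * w 0 +
        (k b * k q + k b * k r + k a * k q) * w 1) := by
    intro w
    simp only [systemMatrix, funext_iff, Fin.forall_fin_two, Matrix.mulVec, dotProduct,
      Fin.sum_univ_two, Matrix.map_apply, Matrix.of_apply, Matrix.cons_val_zero,
      Matrix.cons_val_one, Pi.zero_apply, Int.cast_sub, Int.cast_mul, Int.cast_add, Int.cast_neg,
      Int.cast_one, hσ']
    refine and_congr ⟨fun h => ?_, fun h => ?_⟩ ⟨fun h => ?_, fun h => ?_⟩ <;>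
      linear_combination h
  simp only [hx, key]
  simp only [ArcRelations, outer, if_true, if_false, Bool.false_eq_true]
  refine Nat.card_congr (Equiv.ofBijective
    (fun x => ((x.1 p).1, ⟨![(x.1 p).1 - (x.1 p).2, (x.1 q).1 - (x.1 q).2], ?_⟩)) ⟨?_, ?_⟩)
  · obtain ⟨x, e1, e2, e3, e4, e5, e6, e7, e8, e9, e10, e11, e12⟩ := x
    simp only [Matrix.cons_val_zero, Matrix.cons_val_one]
    -- Subtract the two relations in a triangle: the difference along the row on `T'` is preserved,
    -- and the hub relation cancels the unshifted colours.
    have ha : (x a).1 - (x a).2 = μ * (k p * ((x p).1 - (x p).2) - k q * ((x q).1 - (x q).2)) := by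
      linear_combination e8 - e7 + e1
    have hb : (x b).1 - (x b).2 = μ * (k q * ((x q).1 - (x q).2) - k r * ((x r).1 - (x r).2)) := by
      linear_combination e10 - e9 + e2
    have hc : (x c).1 - (x c).2 = μ * (k r * ((x r).1 - (x r).2) - k p * ((x p).1 - (x p).2)) := by
      linear_combination e12 - e11 + e3
    have hr : (x r).1 - (x r).2 = -((x p).1 - (x p).2) - ((x q).1 - (x q).2) := by
      linear_combination e1 + e2 + e3
    constructor
    · linear_combination e7 - e12 + e4 + ν * k a * ha - ν * k c * hc - ν * k c * μ * k r * hr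
    · linear_combination e9 - e8 + e5 + ν * k b * hb - ν * k a * ha - ν * k b * μ * k r * hr
  · rintro ⟨x, e1, e2, e3, e4, e5, e6, e7, e8, e9, e10, e11, e12⟩
      ⟨y, d1, d2, d3, d4, d5, d6, d7, d8, d9, d10, d11, d12⟩ h
    simp only [Prod.mk.injEq, Subtype.mk.injEq] at h
    obtain ⟨hp1, h⟩ := h
    have hu : (x p).1 - (x p).2 = (y p).1 - (y p).2 := congrFun h 0
    have hv : (x q).1 - (x q).2 = (y q).1 - (y q).2 := congrFun h 1
    have hp2 : (x p).2 = (y p).2 := by linear_combination hp1 - hu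
    have hq2 : (x q).2 = (y q).2 := by rw [← e1, ← d1, hp1]
    have hq1 : (x q).1 = (y q).1 := by linear_combination hq2 + hv
    have hr2 : (x r).2 = (y r).2 := by rw [← e2, ← d2, hq1]
    have hr1 : (x r).1 = (y r).1 := by rw [e3, d3, hp2]
    have ha : (x a).1 - (x a).2 = (y a).1 - (y a).2 := by
      linear_combination e8 - e7 + e1 - (d8 - d7 + d1) + μ * (k p * hu - k q * hv)
    have ha1 : (x a).1 = (y a).1 := by
      linear_combination d7 - e7 + hp1 + k p * μ * hu - k a * ν * ha
    have ha2 : (x a).2 = (y a).2 := by linear_combination ha1 - ha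
    have hb1 : (x b).1 = (y b).1 := by rw [e5, d5, ha2]
    have hb : (x b).1 - (x b).2 = (y b).1 - (y b).2 := by
      linear_combination e10 - e9 + e2 - (d10 - d9 + d2) + μ * (k q * hv - k r * (hr1 - hr2))
    have hb2 : (x b).2 = (y b).2 := by linear_combination hb1 - hb
    have hc1 : (x c).1 = (y c).1 := by rw [e6, d6, hb2]
    have hc2 : (x c).2 = (y c).2 := by rw [← e4, ← d4, ha1]
    refine Subtype.ext (funext fun e => ?_)
    cases e
    exacts [Prod.ext hp1 hp2, Prod.ext hq1 hq2, Prod.ext hr1 hr2, Prod.ext ha1 ha2,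
      Prod.ext hb1 hb2, Prod.ext hc1 hc2]
  · rintro ⟨X, w, h1, h2⟩
    obtain ⟨A, hA⟩ : ∃ A, A = μ * (k p * w 0 - k q * w 1) := ⟨_, rfl⟩
    obtain ⟨B, hB⟩ : ∃ B, B = μ * (k q * w 1 - k r * (-w 0 - w 1)) := ⟨_, rfl⟩
    -- `A` and `B` are the forced differences along `a` and `b`; `Y` solves the relation between the
    -- left strands of `p` and `a` for the outer colour.
    obtain ⟨Y, hY⟩ : ∃ Y, Y = X + k p * μ * w 0 - k a * ν * A := ⟨_, rfl⟩
    refine ⟨⟨fun | p => (X, X - w 0) | q => (X + w 1, X) | r => (X - w 0, X + w 1)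
                 | a => (Y, Y - A) | b => (Y - A, Y - A - B) | c => (Y - A - B, Y), ?_⟩, ?_⟩
    · refine ⟨rfl, rfl, rfl, rfl, rfl, rfl, ?_, ?_, ?_, ?_, ?_, ?_⟩ <;> dsimp only <;> rw [hY]
      · ring
      · linear_combination hA
      · rw [hB, hA]
        linear_combination h2
      · rw [hB, hA]
        linear_combination h2
      · rw [hB, hA]
        linear_combination -h1
      · rw [hB, hA]
        linear_combination -h1
    · refine Prod.ext rfl (Subtype.ext (funext fun i => ?_))
      fin_cases i <;> simp

end Girth3

/-! ### Counting solutions of integral linear systems over finite rings -/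

/-- The number of solutions modulo `m` of a system of linear equations whose determinant
divides `m`. -/
theorem Matrix.card_ker_zmod {ι : Type*} [Fintype ι] [DecidableEq ι] (A : Matrix ι ι ℤ) {m : ℕ}
    (hm : m ≠ 0) (hA : A.det ∣ m) :
    Nat.card {v : ι → ZMod m // (A.map (Int.cast : ℤ → ZMod m)).mulVec v = 0} = A.det.natAbs := by
  obtain ⟨e, he⟩ := hA
  have hm' : (m : ℤ) ≠ 0 := by exact_mod_cast hm
  have hd : A.det ≠ 0 := by rintro h; simp [h] at he; exact hm he
  have he0 : e ≠ 0 := by rintro rfl; simp at he; exact hm he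
  have hadj : ∀ w, A.mulVec (A.adjugate.mulVec w) = A.det • w := fun w => by
    rw [Matrix.mulVec_mulVec, Matrix.mul_adjugate, Matrix.smul_mulVec, Matrix.one_mulVec]
  have hadj' : ∀ w, A.adjugate.mulVec (A.mulVec w) = A.det • w := fun w => by
    rw [Matrix.mulVec_mulVec, Matrix.adjugate_mul, Matrix.smul_mulVec, Matrix.one_mulVec]
  have hinj : Function.Injective A.mulVecLin := by
    rw [← LinearMap.ker_eq_bot, LinearMap.ker_eq_bot']
    intro w hw
    have := hadj' w
    rw [show A.mulVec w = 0 from hw, Matrix.mulVec_zero] at this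
    exact (smul_eq_zero.1 this.symm).resolve_left hd
  have hcast : ∀ w : ι → ℤ, (A.map (Int.cast : ℤ → ZMod m)).mulVec (fun i => (w i : ZMod m)) =
      fun i => ((A.mulVec w i : ℤ) : ZMod m) := by
    intro w
    funext i
    simp [Matrix.mulVec, dotProduct]
  -- With m = det(A) · e, the vectors e · adj(A)w modulo m are exactly the solutions, and such a
  -- vector vanishes modulo m precisely when w lies in the image of A. So the solutions form a copy
  -- of ℤ^ι / Aℤ^ι.
  let φ : (ι → ℤ) →+ (ι → ZMod m) :=
    { toFun := fun w i => ((e * A.adjugate.mulVec w i : ℤ) : ZMod m)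
      map_zero' := by simp; rfl
      map_add' := fun w w' => by
        funext i
        simp [Matrix.mulVec_add, mul_add] }
  have hφ : ∀ v : ι → ZMod m, v ∈ φ.range ↔ (A.map (Int.cast : ℤ → ZMod m)).mulVec v = 0 := by
    intro v
    constructor
    · rintro ⟨w, rfl⟩
      have := hcast (e • A.adjugate.mulVec w)
      rw [Matrix.mulVec_smul, hadj, smul_smul, mul_comm e, ← he] at this
      refine (Eq.trans ?_ this).trans ?_
      · rfl
      · funext i
        simp
    · intro hv
      obtain ⟨w, rfl⟩ : ∃ w : ι → ℤ, v = fun i => (w i : ZMod m) :=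
        ⟨fun i => (v i).cast, by funext i; simp⟩
      rw [hcast] at hv
      have : ∀ i, ∃ z, A.mulVec w i = m * z := fun i =>
        (ZMod.intCast_zmod_eq_zero_iff_dvd _ _).1 (congrFun hv i)
      choose z hz using this
      refine ⟨z, funext fun i => ?_⟩
      have h1 : A.mulVec w = (m : ℤ) • z := funext hz
      have h2 := hadj' w
      rw [h1, Matrix.mulVec_smul, he, mul_smul] at h2
      have h3 := smul_right_injective _ hd h2
      exact congrArg (Int.cast : ℤ → ZMod m) (congrFun h3 i)
  have hker : φ.ker = (LinearMap.range A.mulVecLin).toAddSubgroup := by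
    ext w
    rw [AddMonoidHom.mem_ker]
    constructor
    · intro hw
      have : ∀ i, ∃ z, e * A.adjugate.mulVec w i = m * z := fun i =>
        (ZMod.intCast_zmod_eq_zero_iff_dvd _ _).1 (congrFun hw i)
      choose z hz using this
      refine ⟨z, ?_⟩
      have h1 : A.adjugate.mulVec w = A.det • z := funext fun i => by
        refine mul_left_cancel₀ he0 ?_
        rw [hz, he, Pi.smul_apply, smul_eq_mul]
        ring
      have h2 := hadj w
      rw [h1, Matrix.mulVec_smul] at h2
      exact smul_right_injective _ hd h2
    · rintro ⟨z, rfl⟩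
      funext i
      have h1 := congrFun (hadj' z) i
      change ((e * A.adjugate.mulVec (A.mulVec z) i : ℤ) : ZMod m) = 0
      rw [h1, Pi.smul_apply, smul_eq_mul, ← mul_assoc, mul_comm e, ← he]
      simp
  have h1 : Nat.card {v : ι → ZMod m // (A.map (Int.cast : ℤ → ZMod m)).mulVec v = 0} =
      Nat.card φ.range := Nat.card_congr (Equiv.subtypeEquivRight fun v => (hφ v).symm)
  rw [h1, ← Nat.card_congr (QuotientAddGroup.quotientKerEquivRange φ).toEquiv, hker]
  -- The index of the image of an injective lattice endomorphism is the absolute value of its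
  -- determinant.
  have h2 := Submodule.natAbs_det_equiv (LinearMap.range A.mulVecLin)
    (LinearEquiv.ofInjective A.mulVecLin hinj)
  refine h2.symm.trans (congrArg Int.natAbs ?_)
  rw [← LinearMap.det_toLin']
  congr 1

/-- The same count over a quadratic algebra. -/
theorem Matrix.card_ker_quadraticAlgebra {ι : Type*} [Fintype ι] [DecidableEq ι]
    (A : Matrix ι ι ℤ) {m : ℕ} (hm : m ≠ 0) (hA : A.det ∣ m) (x y : ZMod m) :
    Nat.card {v : ι → QuadraticAlgebra (ZMod m) x y //
      (A.map (Int.cast : ℤ → QuadraticAlgebra (ZMod m) x y)).mulVec v = 0} =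
        A.det.natAbs ^ 2 := by
  rw [sq, ← A.card_ker_zmod hm hA, ← Nat.card_prod]
  -- Integer coefficients act separately on the two coordinates, hence the square.
  have h : ∀ v : ι → QuadraticAlgebra (ZMod m) x y,
      (A.map (Int.cast : ℤ → QuadraticAlgebra (ZMod m) x y)).mulVec v = 0 ↔
        (A.map (Int.cast : ℤ → ZMod m)).mulVec (fun i => (v i).re) = 0 ∧
        (A.map (Int.cast : ℤ → ZMod m)).mulVec (fun i => (v i).im) = 0 := by
    intro v
    simp only [funext_iff, ← forall_and, QuadraticAlgebra.ext_iff]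
    refine forall_congr' fun i => and_congr (Eq.congr ?_ rfl) (Eq.congr ?_ rfl)
    · simp only [Matrix.mulVec, dotProduct]
      rw [← QuadraticAlgebra.reₗ_apply (R := ZMod m), map_sum]
      simp
    · simp only [Matrix.mulVec, dotProduct]
      rw [← QuadraticAlgebra.imₗ_apply (R := ZMod m), map_sum]
      simp
  refine Nat.card_congr ⟨fun v => (⟨fun i => (v.1 i).re, ((h v.1).1 v.2).1⟩,
    ⟨fun i => (v.1 i).im, ((h v.1).1 v.2).2⟩), fun w => ⟨fun i => ⟨w.1.1 i, w.2.1 i⟩,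
      (h _).2 ⟨w.1.2, w.2.2⟩⟩, fun v => rfl, fun w => rfl⟩

/-! ### The determinant as a knot invariant -/

namespace Girth3

open DiagramCode TreeEdge

/-- `t` with `t + t⁻¹ = 2 - σ`. -/
def quadraticUnit (m : ℕ) (σ : ℤ) : (QuadraticAlgebra (ZMod m) (-1) (2 - σ))ˣ where
  val := ⟨0, 1⟩
  -- The generator ω satisfies ω² = -1 + (2 - σ)ω, so ω(2 - σ - ω) = 1.
  inv := ⟨2 - σ, -1⟩
  val_inv := by ext <;> simp <;> rfl
  inv_val := by ext <;> simp <;> rfl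

theorem quadraticUnit_add_inv (m : ℕ) (σ : ℤ) :
    (quadraticUnit m σ + ↑(quadraticUnit m σ)⁻¹ : QuadraticAlgebra (ZMod m) (-1) (2 - σ)) =
      2 - σ := by
  ext <;> simp [quadraticUnit, Units.inv_mk] <;> rfl

theorem colorCounts_K {k : TreeEdge → ℤ} (σ : ℤ) {m : ℕ} (hm : m ≠ 0)
    (hd : (systemMatrix σ k).det ∣ m) :
    colorCounts (quadraticUnit m σ)
      (K (2 * k p) (2 * k q) (2 * k r) (2 * k a) (2 * k b) (2 * k c)) =
      {m ^ 2 * (systemMatrix σ k).det.natAbs ^ 2} := by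
  have hcount : ∀ s, Nat.card (colorings (quadraticUnit m σ)
      ((KEnds fun e => 2 * k e).orient (direction s))) =
      m ^ 2 * (systemMatrix σ k).det.natAbs ^ 2 := by
    intro s
    rw [card_colorings_orient_direction, card_arcRelations _ k s σ (quadraticUnit_add_inv m σ),
      Matrix.card_ker_quadraticAlgebra _ hm hd, Nat.card_congr (QuadraticAlgebra.equivProd _ _),
      Nat.card_prod, Nat.card_zmod, sq m]
  have hiff := fun E => isOrientation_K_iff (n := fun e => 2 * k e)
    (fun e => even_two_mul _) (E := E)
  ext N
  constructor
  · rintro ⟨E, hE, rfl⟩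
    obtain ⟨s, rfl⟩ := (hiff E).1 hE
    exact hcount s
  · rintro rfl
    exact ⟨_, (hiff _).2 ⟨true, rfl⟩, hcount true⟩

/-- Taking m as the absolute value of the product of the two determinants makes it a multiple of
both, so the counts give equality up to sign. Both are 1 modulo σ; opposite signs would force σ to
divide 2, and vanishing would force it to divide 1. -/
theorem det_systemMatrix_eq_of_sameKnot {k k' : TreeEdge → ℤ} {σ : ℤ} (hσ : 3 ≤ σ)
    (h : SameKnot (K (2 * k p) (2 * k q) (2 * k r) (2 * k a) (2 * k b) (2 * k c))
      (K (2 * k' p) (2 * k' q) (2 * k' r) (2 * k' a) (2 * k' b) (2 * k' c))) :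
    (systemMatrix σ k).det = (systemMatrix σ k').det := by
  have hmod : ∀ k, ∃ z, (systemMatrix σ k).det = 1 + σ * z := fun k => by
    rw [det_systemMatrix]
    exact ⟨-(k p * (k a + k c) + k q * (k a + k b) + k r * (k b + k c)) +
      σ * ((k p * k q + k q * k r + k r * k p) * (k a * k b + k b * k c + k c * k a)), by ring⟩
  obtain ⟨z, hz⟩ := hmod k
  obtain ⟨z', hz'⟩ := hmod k'
  have hne : ∀ z, 1 + σ * z ≠ 0 := fun z h => by
    have : σ ∣ 1 := ⟨-z, by linarith⟩
    have := Int.le_of_dvd one_pos this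
    omega
  set d := (systemMatrix σ k).det
  set d' := (systemMatrix σ k').det
  have hm : (d * d').natAbs ≠ 0 := by
    rw [Int.natAbs_ne_zero, hz, hz']
    exact mul_ne_zero (hne z) (hne z')
  have h1 := h.colorCounts_eq (quadraticUnit (d * d').natAbs σ)
  rw [colorCounts_K σ hm (Int.dvd_natAbs.2 (dvd_mul_right d d')),
    colorCounts_K σ hm (Int.dvd_natAbs.2 (dvd_mul_left d' d)), Set.singleton_eq_singleton_iff] at h1
  have h2 := Nat.pow_left_injective (n := 2) two_ne_zero
    (Nat.eq_of_mul_eq_mul_left (pow_pos (Nat.pos_of_ne_zero hm) 2) h1)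
  rcases Int.natAbs_eq_natAbs_iff.1 h2 with h3 | h3
  · exact h3
  · exfalso
    change d = -d' at h3
    rw [hz, hz'] at h3
    have : σ ∣ 2 := ⟨-z - z', by linarith⟩
    have := Int.le_of_dvd two_pos this
    omega

end Girth3

/-! ### Comparison of the two polynomials -/

theorem theorem4p10 (p q r a b c : ℤ)
    (hp : Even p) (hq : Even q) (hr : Even r) (ha : Even a) (hb : Even b) (hc : Even c)
    (hpa : p ≠ a)
    (h : DiagramCode.SameKnot (Girth3.K p q r a b c) (Girth3.K a q r p b c)) :
    (q = 0 ∧ c = 0) ∨ (q = c ∧ b = r) := by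
  obtain ⟨p, rfl⟩ := hp.two_dvd
  obtain ⟨q, rfl⟩ := hq.two_dvd
  obtain ⟨r, rfl⟩ := hr.two_dvd
  obtain ⟨a, rfl⟩ := ha.two_dvd
  obtain ⟨b, rfl⟩ := hb.two_dvd
  obtain ⟨c, rfl⟩ := hc.two_dvd
  let k : TreeEdge → ℤ := fun | .p => p | .q => q | .r => r | .a => a | .b => b | .c => c
  let k' : TreeEdge → ℤ := fun | .p => a | .q => q | .r => r | .a => p | .b => b | .c => c
  have hd : ∀ σ : ℤ, 3 ≤ σ →
      1 - σ * (p * (a + c) + q * (a + b) + r * (b + c)) +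
        σ ^ 2 * ((p * q + q * r + r * p) * (a * b + b * c + c * a)) =
      1 - σ * (a * (p + c) + q * (p + b) + r * (b + c)) +
        σ ^ 2 * ((a * q + q * r + r * a) * (p * b + b * c + c * p)) := by
    intro σ hσ
    have := Girth3.det_systemMatrix_eq_of_sameKnot (k := k) (k' := k') hσ h
    rwa [Girth3.det_systemMatrix, Girth3.det_systemMatrix] at this
  -- After cancelling 1 and one factor σ, the equation is affine in σ, so two values suffice to
  -- compare both coefficients.
  have h3 := hd 3 le_rfl
  have h4 := hd 4 (by norm_num)
  have hne : p - a ≠ 0 := fun h => hpa (by rw [sub_eq_zero.1 h])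
  have hqc : q = c := by
    -- This product is the difference of the coefficients of σ, up to sign.
    have : (p - a) * (c - q) = 0 := by linarith
    have := (mul_eq_zero.1 this).resolve_left hne
    omega
  subst hqc
  -- With `q = c` substituted, this is the difference of the coefficients of σ², up to sign.
  have h5 : (p - a) * (q * q * (r - b)) = 0 := by nlinarith
  rcases mul_eq_zero.1 ((mul_eq_zero.1 h5).resolve_left hne) with h6 | h6
  · left
    simpa using h6
  · right
    exact ⟨rfl, by linarith⟩
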